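/- There exist an absolute constant $C$ and a polynomial-time algorithm that, given a 3-CNF-SAT formula $\Phi$ (a finite conjunction of clauses, each of them a disjunction of at most three literals) with $n$ variables and $m$ clauses, constructs an equivalent \textsc{Edge Clique Cover} instance $(G,k)$ with $k = O(\log n)$ and $|V(G)| = O(n+m)$; that is, $G$ is a finite simple undirected graph and $k\ge 0$ an integer such that 1. $\Phi$ is satisfiable if and only if there are at most $k$ cliques of $G$ such that every edge of $G$ is contained in at least one of them; 2. $k \le C\,(1+\log n)$ (where $\log 0$ is read as $0$); 3. $|V(G)| \le C\,(n+m)$. Here $n$ is the number of distinct variables that occur in $\Phi$. The algorithm is a deterministic Turing machine whose running time is bounded by a polynomial in the length of the encoding of $\Phi$ (the list of clauses, each the list of its literals, with the variable names written in binary); its output is the adjacency matrix of $G$ followed by $k$ in unary. -/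

import Mathlib

/-! ### Formulas -/

/-- A literal: a variable, named by a natural number, and a sign
(`true` for the variable itself, `false` for its negation). -/
abbrev Lit : Type := ℕ × Bool

/-- A clause: the disjunction of a finite list of literals. -/
abbrev Clause : Type := List Lit

/-- A formula in conjunctive normal form: the conjunction of a finite list of clauses. -/
abbrev CNFFormula : Type := List Clause

namespace CNFFormula

/-- The formula has a satisfying assignment. -/
def Satisfiable (φ : CNFFormula) : Prop :=
  ∃ a : ℕ → Bool, ∀ c ∈ φ, ∃ l ∈ c, a l.1 = l.2

/-- The set of variables that occur in the formula. -/
def vars (φ : CNFFormula) : Finset ℕ :=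
  (φ.flatten.map Prod.fst).toFinset

/-- The number of variables. -/
def numVars (φ : CNFFormula) : ℕ := φ.vars.card

/-- The number of clauses (counted with repetitions). -/
def numClauses (φ : CNFFormula) : ℕ := φ.length

end CNFFormula

/-- A 3-CNF formula: every clause has at most three literals. -/
abbrev ThreeCNF : Type := {φ : CNFFormula // ∀ c ∈ φ, c.length ≤ 3}

/-! ### Edge Clique Cover -/

/-- The edges of `G` can be covered by at most `k` cliques of `G`
(a clique is given by its vertex set). -/
def HasEdgeCliqueCover {V : Type*} (G : SimpleGraph V) (k : ℕ) : Prop :=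
  ∃ 𝒞 : Finset (Set V), 𝒞.card ≤ k ∧ (∀ K ∈ 𝒞, G.IsClique K) ∧
    ∀ u v, G.Adj u v → ∃ K ∈ 𝒞, u ∈ K ∧ v ∈ K

/-- An instance `(G, k)` of Edge Clique Cover; the vertices are numbered. -/
structure ECCInstance where
  numVerts : ℕ
  graph : SimpleGraph (Fin numVerts)
  k : ℕ

/-- `(G, k)` is a YES-instance. -/
def ECCInstance.IsYes (I : ECCInstance) : Prop := HasEdgeCliqueCover I.graph I.k

/-! ### Encodings over finite alphabets -/

/-- The alphabet in which formulas are written. -/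
inductive CNFSymbol
  | clause
  | lit (sign : Bool)
  | bit (b : Bool)
  deriving DecidableEq, Fintype

/-- A literal is written as its sign followed by the binary digits of its variable. -/
def encodeLit (l : Lit) : List CNFSymbol :=
  .lit l.2 :: (Computability.encodeNat l.1).map .bit

/-- A clause is written as a marker followed by its literals. -/
def encodeClause (c : Clause) : List CNFSymbol :=
  .clause :: c.flatMap encodeLit

/-- A 3-CNF formula is written as the sequence of its clauses. -/
def encodeThreeCNF (φ : ThreeCNF) : List CNFSymbol :=
  φ.1.flatMap encodeClause

/-- The alphabet in which instances of Edge Clique Cover are written. -/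
inductive ECCSymbol
  | row
  | entry (b : Bool)
  | budget
  deriving DecidableEq, Fintype

open Classical in
/-- The row of the adjacency matrix that belongs to the vertex `u`, preceded by a marker. -/
noncomputable def encodeRow {N : ℕ} (G : SimpleGraph (Fin N)) (u : Fin N) : List ECCSymbol :=
  .row :: (List.finRange N).map fun v => .entry (decide (G.Adj u v))

/-- An instance `(G, k)` is written as the adjacency matrix of `G`, row by row, followed by
`k` in unary. -/
noncomputable def encodeECC (I : ECCInstance) : List ECCSymbol :=
  (List.finRange I.numVerts).flatMap (encodeRow I.graph) ++ List.replicate I.k .budget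

/-! ### Structured programs on stacks -/

/-! Satisfiability is expressed as a 4-colouring problem for a clash relation on a vertex set W. The
vertices `fls`, `tru` and the two extra ones clash pairwise and thereby name four colours. The two
literals of a variable clash with each other and with the extra vertices, so one of them gets the
colour of `tru` and the other that of `fls`. The three vertices of a clause clash with one another
and with `fls`; hence one of them has the colour of `tru`. Such a vertex clashes with `tru` if its
slot is empty, and with the negation of its literal otherwise, so its literal is true. See
`exists_coloring` and `sat_of_cover`.

The graph joins the vertices of W that do not clash, adds a hub joined to all of W, and adds a pair
of adjacent twins for each index (feature pair, digit weight). Twins of different indices are not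
adjacent, and no twin is adjacent to the hub. So each twin pair uses up a clique of its own that
misses the hub, and a budget of 4 plus the number of twin pairs leaves four cliques for the edges at
the hub: their traces on W are the colour classes (`sat_of_hasEdgeCliqueCover`).

Conversely, the four colour classes, with the hub added, cover the edges at the hub, and the cliques
around the twins must cover all edges inside W whatever the colouring is. This is where the
logarithm arises. Whether two vertices clash depends on their kinds, on which slots are filled, on
signs, and on equality of variables; distinct variables differ in some binary digit of their
numbers. So every non-clashing pair is separated by one of boundedly many feature pairs at one of
O(log n) digits, and all bearers of these two features form a clique (`covered_of_not_clash`).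
Clause vertices clash according to the contents of their clauses, not their positions, so the number
of clauses does not enter the budget.

For the running time, vertices are named by a kind and a position in the input word. The adjacency
relation is defined from symbol tests and comparisons of positions by Boolean connectives,
quantifiers over positions and counting. Programs with a fixed number of pointers into the input
evaluate such definitions in polynomial time and print the matrix by nested loops (`Definable`,
`Emittable`); a pointer is simulated by two stacks. `sat_system_iff` identifies the formula read off
the word with the given one. -/

/-- Structured programs that act on finitely many stacks and a finite control state. -/
inductive StackProg {K : Type} (Γ : K → Type) (σ : Type) : Type
  | push (k : K) (f : σ → Γ k)
  | pop (k : K) (f : σ → Option (Γ k) → σ)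
  | peek (k : K) (f : σ → Option (Γ k) → σ)
  | load (f : σ → σ)
  | seq (p q : StackProg Γ σ)
  | ite (c : σ → Bool) (p q : StackProg Γ σ)
  | loop (c : σ → Bool) (p : StackProg Γ σ)

namespace StackProg

open Turing Function

variable {K : Type} {Γ : K → Type} {σ : Type}

/-- The labels of the machine that executes a program. -/
def Lab : StackProg Γ σ → Type
  | push _ _ | pop _ _ | peek _ _ | load _ => Unit
  | seq p q => Lab p ⊕ Lab q
  | ite _ p q => Option (Lab p ⊕ Lab q)
  | loop _ p => Option (Lab p)

/-- The label at which the execution of a program starts. -/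
def entry : (p : StackProg Γ σ) → Lab p
  | push _ _ | pop _ _ | peek _ _ | load _ => ()
  | seq p _ => Sum.inl p.entry
  | ite _ _ _ | loop _ _ => none

noncomputable instance fintypeLab : (p : StackProg Γ σ) → Fintype (Lab p)
  | push _ _ | pop _ _ | peek _ _ | load _ => inferInstanceAs (Fintype Unit)
  | seq p q =>
    letI := fintypeLab p
    letI := fintypeLab q
    inferInstanceAs (Fintype (Lab p ⊕ Lab q))
  | ite _ p q =>
    letI := fintypeLab p
    letI := fintypeLab q
    inferInstanceAs (Fintype (Option (Lab p ⊕ Lab q)))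
  | loop _ p =>
    letI := fintypeLab p
    inferInstanceAs (Fintype (Option (Lab p)))

/-- The code of a program, whose labels are embedded into `Λ` by `emb`, and which continues at
`exit`. -/
def code {Λ : Type} : (p : StackProg Γ σ) → (Lab p → Λ) → Λ → Lab p → TM2.Stmt Γ Λ σ
  | push k f, _, exit, _ => .push k f (.goto fun _ => exit)
  | pop k f, _, exit, _ => .pop k f (.goto fun _ => exit)
  | peek k f, _, exit, _ => .peek k f (.goto fun _ => exit)
  | load f, _, exit, _ => .load f (.goto fun _ => exit)
  | seq p q, emb, exit, l =>
    match l with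
    | Sum.inl l => p.code (fun l => emb (Sum.inl l)) (emb (Sum.inr q.entry)) l
    | Sum.inr l => q.code (fun l => emb (Sum.inr l)) exit l
  | ite c p q, emb, exit, l =>
    match l with
    | none => .branch c (.goto fun _ => emb (some (Sum.inl p.entry)))
        (.goto fun _ => emb (some (Sum.inr q.entry)))
    | some (Sum.inl l) => p.code (fun l => emb (some (Sum.inl l))) exit l
    | some (Sum.inr l) => q.code (fun l => emb (some (Sum.inr l))) exit l
  | loop c p, emb, exit, l =>
    match l with
    | none => .branch c (.goto fun _ => emb (some p.entry)) (.goto fun _ => exit)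
    | some l => p.code (fun l => emb (some l)) (emb none) l

/-! ### Timed semantics of programs and its simulation by machines. -/

variable [DecidableEq K]

/-- `Exec p t (v, S) (v', S')`: started with control state `v` and stacks `S`, the program `p`
ends after `t` steps with control state `v'` and stacks `S'`. -/
inductive Exec : StackProg Γ σ → ℕ → σ × (∀ k, List (Γ k)) → σ × (∀ k, List (Γ k)) → Prop
  | push (k : K) (f : σ → Γ k) (v : σ) (S : ∀ k, List (Γ k)) :
    Exec (push k f) 1 (v, S) (v, update S k (f v :: S k))
  | pop (k : K) (f : σ → Option (Γ k) → σ) (v : σ) (S : ∀ k, List (Γ k)) :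
    Exec (pop k f) 1 (v, S) (f v (S k).head?, update S k (S k).tail)
  | peek (k : K) (f : σ → Option (Γ k) → σ) (v : σ) (S : ∀ k, List (Γ k)) :
    Exec (peek k f) 1 (v, S) (f v (S k).head?, S)
  | load (f : σ → σ) (v : σ) (S : ∀ k, List (Γ k)) : Exec (load f) 1 (v, S) (f v, S)
  | seq {p q : StackProg Γ σ} {t t' : ℕ} {a b c : σ × (∀ k, List (Γ k))} :
    Exec p t a b → Exec q t' b c → Exec (seq p q) (t' + t) a c
  | ite_true {c : σ → Bool} {p q : StackProg Γ σ} {t : ℕ} {a b : σ × (∀ k, List (Γ k))} :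
    c a.1 = true → Exec p t a b → Exec (ite c p q) (t + 1) a b
  | ite_false {c : σ → Bool} {p q : StackProg Γ σ} {t : ℕ} {a b : σ × (∀ k, List (Γ k))} :
    c a.1 = false → Exec q t a b → Exec (ite c p q) (t + 1) a b
  | loop_done {c : σ → Bool} {p : StackProg Γ σ} {a : σ × (∀ k, List (Γ k))} :
    c a.1 = false → Exec (loop c p) 1 a a
  | loop_step {c : σ → Bool} {p : StackProg Γ σ} {t t' : ℕ} {a b d : σ × (∀ k, List (Γ k))} :
    c a.1 = true → Exec p t a b → Exec (loop c p) t' b d → Exec (loop c p) (t' + (t + 1)) a d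

/-- The machine with program `M` gets from one configuration to another in `t` steps. -/
def Reach {Λ : Type} (M : Λ → TM2.Stmt Γ Λ σ) (t : ℕ) (a b : TM2.Cfg Γ Λ σ) : Prop :=
  (flip bind (TM2.step M))^[t] (some a) = some b

theorem Reach.trans {Λ : Type} {M : Λ → TM2.Stmt Γ Λ σ} {t t' : ℕ} {a b c : TM2.Cfg Γ Λ σ}
    (h : Reach M t a b) (h' : Reach M t' b c) : Reach M (t' + t) a c := by
  unfold Reach at *
  rw [iterate_add_apply, h, h']

theorem Reach.one {Λ : Type} {M : Λ → TM2.Stmt Γ Λ σ} {l : Λ} {v : σ} {S : ∀ k, List (Γ k)}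
    {b : TM2.Cfg Γ Λ σ} (h : TM2.stepAux (M l) v S = b) : Reach M 1 ⟨some l, v, S⟩ b := by
  subst h; rfl

/-- The code of a program simulates the program. -/
theorem Exec.reach {Λ : Type} {M : Λ → TM2.Stmt Γ Λ σ} {p : StackProg Γ σ} {t : ℕ}
    {a b : σ × (∀ k, List (Γ k))} (h : Exec p t a b) :
    ∀ (emb : Lab p → Λ) (exit : Λ), (∀ l, M (emb l) = p.code emb exit l) →
      Reach M t ⟨some (emb p.entry), a.1, a.2⟩ ⟨some exit, b.1, b.2⟩ := by
  induction h with
  | push | pop | peek | load =>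
    intro emb exit h
    apply Reach.one
    rw [h]; rfl
  | @seq p q t t' a b c _ _ ih₁ ih₂ =>
    intro emb exit h
    exact (ih₁ (fun l => emb (Sum.inl l)) (emb (Sum.inr q.entry)) fun l => h (Sum.inl l)).trans
      (ih₂ (fun l => emb (Sum.inr l)) exit fun l => h (Sum.inr l))
  | @ite_true c p q t a b hc _ ih =>
    intro emb exit h
    refine Reach.trans (Reach.one ?_)
      (ih (fun l => emb (some (Sum.inl l))) exit fun l => h (some (Sum.inl l)))
    rw [show entry (ite c p q) = none from rfl, h none]
    simp [code, hc]
  | @ite_false c p q t a b hc _ ih =>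
    intro emb exit h
    refine Reach.trans (Reach.one ?_)
      (ih (fun l => emb (some (Sum.inr l))) exit fun l => h (some (Sum.inr l)))
    rw [show entry (ite c p q) = none from rfl, h none]
    simp [code, hc]
  | @loop_done c p a hc =>
    intro emb exit h
    refine Reach.one ?_
    rw [show entry (loop c p) = none from rfl, h none]
    simp [code, hc]
  | @loop_step c p t t' a b d hc _ _ ih₁ ih₂ =>
    intro emb exit h
    refine Reach.trans (Reach.trans (Reach.one ?_)
      (ih₁ (fun l => emb (some l)) (emb none) fun l => h (some l))) (ih₂ emb exit h)
    rw [show entry (loop c p) = none from rfl, h none]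
    simp [code, hc]

/-- `Runs p T a b`: started in state `a`, the program `p` ends in state `b` within `T` steps. -/
def Runs (p : StackProg Γ σ) (T : ℕ) (a b : σ × (∀ k, List (Γ k))) : Prop :=
  ∃ t ≤ T, Exec p t a b

section Runs

variable {p q : StackProg Γ σ} {T T' : ℕ} {a b d : σ × (∀ k, List (Γ k))}

theorem Runs.mono (h : Runs p T a b) (hT : T ≤ T') : Runs p T' a b :=
  let ⟨t, ht, h⟩ := h
  ⟨t, ht.trans hT, h⟩

theorem Runs.congr {b' : σ × (∀ k, List (Γ k))} (h : Runs p T a b) (hb : b = b') :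
    Runs p T a b' := hb ▸ h

theorem Runs.congr₂ {a' b' : σ × (∀ k, List (Γ k))} (h : Runs p T a b) (ha : a = a')
    (hb : b = b') : Runs p T a' b' := ha ▸ hb ▸ h

theorem Runs.seq (h : Runs p T a b) (h' : Runs q T' b d) : Runs (p.seq q) (T + T') a d :=
  let ⟨t, ht, h⟩ := h
  let ⟨t', ht', h'⟩ := h'
  ⟨t' + t, by omega, .seq h h'⟩

/-- Programs are nested to the right, whereas the estimates for moving two pointers treat the two
moves as one block. -/
theorem Runs.assoc {r : StackProg Γ σ} (h : Runs ((p.seq q).seq r) T a b) :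
    Runs (p.seq (q.seq r)) T a b := by
  obtain ⟨t, ht, h⟩ := h
  cases h with | seq h h₃ => cases h with | seq h₁ h₂ =>
  exact ⟨_, by omega, .seq h₁ (.seq h₂ h₃)⟩

theorem Runs.push {k : K} {f : σ → Γ k} {v : σ} {S : ∀ k, List (Γ k)} :
    Runs (.push k f) 1 (v, S) (v, update S k (f v :: S k)) := ⟨1, le_rfl, .push ..⟩

theorem Runs.pop {k : K} {f : σ → Option (Γ k) → σ} {v : σ} {S : ∀ k, List (Γ k)} :
    Runs (.pop k f) 1 (v, S) (f v (S k).head?, update S k (S k).tail) := ⟨1, le_rfl, .pop ..⟩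

theorem Runs.peek {k : K} {f : σ → Option (Γ k) → σ} {v : σ} {S : ∀ k, List (Γ k)} :
    Runs (.peek k f) 1 (v, S) (f v (S k).head?, S) := ⟨1, le_rfl, .peek ..⟩

theorem Runs.load {f : σ → σ} {v : σ} {S : ∀ k, List (Γ k)} :
    Runs (.load f) 1 (v, S) (f v, S) := ⟨1, le_rfl, .load ..⟩

theorem Runs.ite_true {c : σ → Bool} (hc : c a.1 = true) (h : Runs p T a b) :
    Runs (.ite c p q) (T + 1) a b :=
  let ⟨t, ht, h⟩ := h
  ⟨t + 1, by omega, .ite_true hc h⟩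

theorem Runs.ite_false {c : σ → Bool} (hc : c a.1 = false) (h : Runs q T a b) :
    Runs (.ite c p q) (T + 1) a b :=
  let ⟨t, ht, h⟩ := h
  ⟨t + 1, by omega, .ite_false hc h⟩

/-- A loop whose body leads from `s i` to `s (i + 1)` as long as `i < n`. -/
theorem Runs.loop {c : σ → Bool} (s : ℕ → σ × (∀ k, List (Γ k))) (n : ℕ)
    (hc : ∀ i < n, c (s i).1 = true) (hn : c (s n).1 = false)
    (h : ∀ i < n, Runs p T (s i) (s (i + 1))) :
    Runs (.loop c p) (n * (T + 1) + 1) (s 0) (s n) := by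
  induction n generalizing s with
  | zero => exact ⟨1, by omega, .loop_done hn⟩
  | succ n ih =>
    obtain ⟨t, ht, h0⟩ := h 0 (by omega)
    obtain ⟨t', ht', h1⟩ := ih (fun i => s (i + 1)) (fun i hi => hc _ (by omega)) hn
      (fun i hi => h _ (by omega))
    exact ⟨t' + (t + 1), by rw [Nat.succ_mul]; omega, .loop_step (hc 0 (by omega)) h0 h1⟩

end Runs

/-- `initList` and `haltList` describe their stacks by a `dite` with a cast; this rewrites them as
an `update` of the empty stacks. -/
theorem dite_eq_update (k₀ k : K) (s : List (Γ k₀)) :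
    (@dite (List (Γ k)) (k = k₀) (inferInstance) (fun h => by rw [h]; exact s) fun _ => []) =
      update (fun _ => []) k₀ s k := by
  by_cases hk : k = k₀
  · subst hk; simp
  · simp [hk]

/-- Functions computed by programs in polynomial time are computed by Turing machines in
polynomial time. -/
theorem tm2ComputableInPolyTime [Fintype K] [Fintype σ] {α β A B : Type} {ea : α → List A}
    {eb : β → List B} {f : α → β} (k₀ k₁ : K) [Fintype (Γ k₀)] (e₀ : Γ k₀ ≃ A) (e₁ : Γ k₁ ≃ B)
    (v₀ : σ) (p : StackProg Γ σ) (T : Polynomial ℕ)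
    (h : ∀ a, Runs p (T.eval (ea a).length)
      (v₀, update (fun _ => []) k₀ ((ea a).map e₀.symm))
      (v₀, update (fun _ => []) k₁ ((eb (f a)).map e₁.symm))) :
    Nonempty (TM2ComputableInPolyTime ea eb f) := by
  let M : Option (Lab p) → TM2.Stmt Γ (Option (Lab p)) σ
    | none => .halt
    | some l => p.code some none l
  let tm : FinTM2 :=
    { K := K, k₀ := k₀, k₁ := k₁, Γ := Γ, Λ := Option (Lab p), main := some p.entry, σ := σ,
      initialState := v₀, m := M }
  -- The additional step executes the `halt` at the exit label `none`.
  refine ⟨⟨⟨tm, e₀, e₁⟩, T + 1, fun a => ?_⟩⟩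
  have key : ∃ t ≤ T.eval (ea a).length + 1, (flip bind (TM2.step M))^[t]
      (some (⟨some (some p.entry), v₀, update (fun _ => []) k₀ ((ea a).map e₀.symm)⟩ :
        TM2.Cfg Γ (Option (Lab p)) σ)) =
      some ⟨none, v₀, update (fun _ => []) k₁ ((eb (f a)).map e₁.symm)⟩ := by
    obtain ⟨t, ht, h⟩ := h a
    refine ⟨1 + t, by omega, ?_⟩
    exact (h.reach (M := M) some none fun _ => rfl).trans (Reach.one rfl)
  have hi : initList tm ((ea a).map e₀.symm) =
      (⟨some (some p.entry), v₀, update (fun _ => []) k₀ ((ea a).map e₀.symm)⟩ :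
        TM2.Cfg Γ (Option (Lab p)) σ) := by
    unfold initList
    congr 1
    funext k
    exact dite_eq_update k₀ k _
  have ho : haltList tm ((eb (f a)).map e₁.symm) =
      (⟨none, v₀, update (fun _ => []) k₁ ((eb (f a)).map e₁.symm)⟩ :
        TM2.Cfg Γ (Option (Lab p)) σ) := by
    unfold haltList
    congr 1
    funext k
    exact dite_eq_update k₁ k _
  have h' : ∃ t ≤ (T + 1).eval (ea a).length, (flip bind tm.step)^[t]
      (some (initList tm ((ea a).map e₀.symm))) =
      some (haltList tm ((eb (f a)).map e₁.symm)) := by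
    rw [hi, ho]
    rw [Polynomial.eval_add, Polynomial.eval_one]
    exact key
  exact ⟨⟨h'.choose, h'.choose_spec.2⟩, h'.choose_spec.1⟩

end StackProg

/-! ### Pointer programs -/

namespace PointerProg

open StackProg Function

/-- The stacks of a machine with `M` pointers into its input: the input, the output, a unary
counter, the reversed output, and for each pointer the parts of the input on its left and right. -/
inductive Stk (M : ℕ) : Type
  | inp
  | out
  | tmp
  | acc
  | lft (i : Fin M)
  | rgt (i : Fin M)
  deriving DecidableEq, Fintype

variable {M : ℕ}

/-- The alphabets of the stacks. -/
abbrev Stk.Alph : Stk M → Type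
  | inp | lft _ | rgt _ => CNFSymbol
  | out | acc => ECCSymbol
  | tmp => Unit

/-- The control state: the result of the last test, a flag that controls loops, and two registers
for symbols in transit. -/
structure Ctl : Type where
  flag : Bool
  go : Bool
  src : Option CNFSymbol
  dst : Option ECCSymbol
  deriving Fintype

/-- Programs with `M` pointers. -/
abbrev Prog (M : ℕ) : Type := StackProg (Stk.Alph (M := M)) Ctl

/-- States of programs with `M` pointers. -/
abbrev PState (M : ℕ) : Type := Ctl × (∀ k : Stk M, List k.Alph)

/-- The contents of all stacks. -/
def cells (I : List CNFSymbol) (O : List ECCSymbol) (n : ℕ) (A : List ECCSymbol)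
    (L R : Fin M → List CNFSymbol) : ∀ k : Stk M, List k.Alph
  | .inp => I
  | .out => O
  | .tmp => List.replicate n ()
  | .acc => A
  | .lft i => L i
  | .rgt i => R i

section cells

variable (I I' : List CNFSymbol) (O O' : List ECCSymbol) (n : ℕ) (A A' : List ECCSymbol)
    (L R : Fin M → List CNFSymbol) (i : Fin M) (s : List CNFSymbol)

@[simp] theorem cells_inp : cells I O n A L R .inp = I := rfl
@[simp] theorem cells_out : cells I O n A L R .out = O := rfl
@[simp] theorem cells_tmp : cells I O n A L R .tmp = List.replicate n () := rfl
@[simp] theorem cells_acc : cells I O n A L R .acc = A := rfl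
@[simp] theorem cells_lft : cells I O n A L R (.lft i) = L i := rfl
@[simp] theorem cells_rgt : cells I O n A L R (.rgt i) = R i := rfl

@[simp] theorem update_inp :
    update (cells I O n A L R) .inp I' = cells I' O n A L R := by
  funext k; cases k <;> simp [update, cells]

@[simp] theorem update_out :
    update (cells I O n A L R) .out O' = cells I O' n A L R := by
  funext k; cases k <;> simp [update, cells]

@[simp] theorem update_acc :
    update (cells I O n A L R) .acc A' = cells I O n A' L R := by
  funext k; cases k <;> simp [update, cells]

theorem update_tmp (m : ℕ) :
    update (cells I O n A L R) .tmp (List.replicate m ()) = cells I O m A L R := by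
  funext k; cases k <;> simp [update, cells]

@[simp] theorem update_lft :
    update (cells I O n A L R) (.lft i) s = cells I O n A (update L i s) R := by
  funext k
  rcases k with _ | _ | _ | _ | j | j <;> try simp [update, cells]
  by_cases h : j = i
  · subst h; simp
  · simp [h]

@[simp] theorem update_rgt :
    update (cells I O n A L R) (.rgt i) s = cells I O n A L (update R i s) := by
  funext k
  rcases k with _ | _ | _ | _ | j | j <;> try simp [update, cells]
  by_cases h : j = i
  · subst h; simp
  · simp [h]

end cells

/-- The state in which every pointer `i` is at position `e i` of the word `x`. -/
def conf (x : List CNFSymbol) (e : Fin M → ℕ) (A : List ECCSymbol) (n : ℕ) (b g : Bool) :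
    PState M :=
  (⟨b, g, none, none⟩,
    cells [] [] n A (fun i => (x.take (e i)).reverse) (fun i => x.drop (e i)))

/-- Move a pointer to the right. -/
def right (i : Fin M) : Prog M :=
  .seq (.pop (.rgt i) fun v o => { v with src := o })
    (.ite (fun v => v.src.isSome)
      (.seq (.push (.lft i) fun v => v.src.getD .clause) (.load fun v => { v with src := none }))
      (.load id))

/-- Move a pointer to the left. -/
def left (i : Fin M) : Prog M :=
  .seq (.pop (.lft i) fun v o => { v with src := o })
    (.ite (fun v => v.src.isSome)
      (.seq (.push (.rgt i) fun v => v.src.getD .clause) (.load fun v => { v with src := none }))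
      (.load id))

theorem update_reverse_take_succ (x : List CNFSymbol) (e : Fin M → ℕ) (i : Fin M)
    (h : e i < x.length) :
    (fun j => (x.take (update e i (e i + 1) j)).reverse) =
      update (fun j => (x.take (e j)).reverse) i (x[e i] :: (x.take (e i)).reverse) := by
  funext j
  by_cases hj : j = i
  · subst hj
    rw [update_self, update_self, List.take_succ_eq_append_getElem h, List.reverse_append]
    rfl
  · simp [hj]

theorem update_drop_succ (x : List CNFSymbol) (e : Fin M → ℕ) (i : Fin M) :
    (fun j => x.drop (update e i (e i + 1) j)) =
      update (fun j => x.drop (e j)) i (x.drop (e i + 1)) := by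
  funext j
  by_cases hj : j = i
  · subst hj; simp
  · simp [hj]

section raw

variable {I : List CNFSymbol} {O : List ECCSymbol} {n : ℕ} {A : List ECCSymbol}
    {L R : Fin M → List CNFSymbol} {i : Fin M} {b g : Bool}

theorem right_runs_cons {c : CNFSymbol} {s : List CNFSymbol} (h : R i = c :: s) :
    Runs (right i) 4 (⟨b, g, none, none⟩, cells I O n A L R)
      (⟨b, g, none, none⟩, cells I O n A (update L i (c :: L i)) (update R i s)) := by
  refine (Runs.seq Runs.pop (Runs.ite_true (by simp [h]) (Runs.seq Runs.push Runs.load))).congr ?_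
  simp [h]

theorem right_runs_nil (h : R i = []) :
    Runs (right i) 4 (⟨b, g, none, none⟩, cells I O n A L R)
      (⟨b, g, none, none⟩, cells I O n A L R) := by
  refine ((Runs.seq Runs.pop (Runs.ite_false (by simp [h]) Runs.load)).congr ?_).mono (by simp)
  simp [h]
  rw [← h, update_eq_self]

theorem left_runs_cons {c : CNFSymbol} {s : List CNFSymbol} (h : L i = c :: s) :
    Runs (left i) 4 (⟨b, g, none, none⟩, cells I O n A L R)
      (⟨b, g, none, none⟩, cells I O n A (update L i s) (update R i (c :: R i))) := by
  refine (Runs.seq Runs.pop (Runs.ite_true (by simp [h]) (Runs.seq Runs.push Runs.load))).congr ?_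
  simp [h]

end raw

/-! ### Moving and comparing pointers. -/

variable (x : List CNFSymbol) (e : Fin M → ℕ) (A : List ECCSymbol) (n : ℕ) (b g : Bool)

theorem right_runs (i : Fin M) (h : e i < x.length) :
    Runs (right i) 4 (conf x e A n b g) (conf x (update e i (e i + 1)) A n b g) := by
  unfold conf
  rw [update_reverse_take_succ x e i h, update_drop_succ]
  exact right_runs_cons (List.drop_eq_getElem_cons h)

/-- A pointer at the end stays there; this is what truncates counters at the length of the word. -/
theorem right_runs_of_le (i : Fin M) (h : x.length ≤ e i) :
    Runs (right i) 4 (conf x e A n b g) (conf x e A n b g) :=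
  right_runs_nil (by simpa using h)

theorem left_runs (i : Fin M) (h : e i < x.length) :
    Runs (left i) 4 (conf x (update e i (e i + 1)) A n b g) (conf x e A n b g) := by
  unfold conf
  rw [update_reverse_take_succ x e i h, update_drop_succ]
  refine (left_runs_cons (c := x[e i]) (s := (x.take (e i)).reverse) (by simp)).congr ?_
  rw [update_idem, update_idem, update_self, ← List.drop_eq_getElem_cons h]
  have h₁ := update_eq_self i fun j => (x.take (e j)).reverse
  have h₂ := update_eq_self i fun j => x.drop (e j)
  rw [h₁, h₂]

/-- Test whether a pointer is not at the end. -/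
def testRight (i : Fin M) : Prog M :=
  .peek (.rgt i) fun v o => { v with go := o.isSome }

/-- Test whether a pointer is not at the beginning. -/
def testLeft (i : Fin M) : Prog M :=
  .peek (.lft i) fun v o => { v with go := o.isSome }

theorem testRight_runs (i : Fin M) :
    Runs (testRight i) 1 (conf x e A n b g) (conf x e A n b (e i < x.length)) := by
  refine Runs.peek.congr ?_
  simp only [conf, cells_rgt, Prod.mk.injEq, Ctl.mk.injEq, and_true, true_and]
  rw [Bool.eq_iff_iff]
  simp

theorem testLeft_runs (i : Fin M) (h : e i ≤ x.length) :
    Runs (testLeft i) 1 (conf x e A n b g) (conf x e A n b (0 < e i)) := by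
  refine Runs.peek.congr ?_
  simp only [conf, cells_lft, Prod.mk.injEq, Ctl.mk.injEq, and_true, true_and]
  rw [Bool.eq_iff_iff]
  rcases x with _ | ⟨c, x⟩
  · simp at h; simp [h]
  · simp [Option.isSome_iff_ne_none, List.take_eq_nil_iff, Nat.pos_iff_ne_zero]

/-- Move a pointer back to the beginning. -/
def rewind (i : Fin M) : Prog M :=
  .seq (testLeft i) (.loop Ctl.go (.seq (left i) (testLeft i)))

theorem rewind_runs (i : Fin M) (h : e i ≤ x.length) :
    Runs (rewind i) (6 * x.length + 2) (conf x e A n b g)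
      (conf x (update e i 0) A n b false) := by
  refine ((testLeft_runs x e A n b g i h).seq (Runs.congr₂ (Runs.loop (T := 4 + 1)
    (fun k => conf x (update e i (e i - k)) A n b (0 < e i - k)) (e i)
    ?_ ?_ ?_) ?_ ?_)).mono (by omega)
  · intro k hk; simpa [conf] using hk
  · simp [conf]
  · intro k hk
    have h₁ := left_runs x (update e i (e i - (k + 1))) A n b (0 < e i - k) i
      (by simp; omega)
    rw [update_idem, update_self, show e i - (k + 1) + 1 = e i - k by omega] at h₁
    have h₂ := testLeft_runs x (update e i (e i - (k + 1))) A n b (0 < e i - k) i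
      (by simp; omega)
    rw [update_self] at h₂
    exact h₁.seq h₂
  · simp
  · simp

/-- Run `p` with the pointer `i` at each position. -/
def forLoop (i : Fin M) (p : Prog M) : Prog M :=
  .seq (testRight i) (.seq (.loop Ctl.go (.seq p (.seq (right i) (testRight i)))) (.seq
    (rewind i) (.load fun v => { v with flag := false })))

/-- `E k` and `A k` describe the pointers and the output before round `k`. The body may move other
pointers but leaves `i` at `k`, since the move of `i` to `k + 1` follows it. -/
theorem forLoop_runs {x : List CNFSymbol} {i : Fin M} {p : Prog M} {T : ℕ} (E : ℕ → Fin M → ℕ)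
    (A : ℕ → List ECCSymbol) (hE : ∀ k, E k i = k)
    (h : ∀ k < x.length, ∀ b g, Runs p T (conf x (E k) (A k) 0 b g)
      (conf x (update (E (k + 1)) i k) (A (k + 1)) 0 false false)) (b g : Bool) :
    Runs (forLoop i p) (x.length * (T + 12) + 6) (conf x (E 0) (A 0) 0 b g)
      (conf x (update (E x.length) i 0) (A x.length) 0 false false) := by
  refine ((testRight_runs x (E 0) (A 0) 0 b g i).seq (Runs.seq (T := x.length * (T + 5 + 1) + 1)
    ((Runs.loop (T := T + 5)
    -- The body clears the flag, so the arbitrary initial value `b` is present only in round 0.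
    (fun k => conf x (E k) (A k) 0 (if k = 0 then b else false) (k < x.length)) x.length
    ?_ ?_ ?_).congr₂ ?_ rfl) (Runs.seq (rewind_runs x _ _ _ _ _ _ ?_)
    (Runs.congr Runs.load ?_)))).mono (by ring_nf; omega)
  · intro k hk; simpa [conf] using hk
  · simp [conf]
  · intro k hk
    have h₁ := h k hk (if k = 0 then b else false) (k < x.length)
    have h₂ := right_runs x (update (E (k + 1)) i k) (A (k + 1)) 0 false false i (by simpa)
    have h₄ : update (E (k + 1)) i (k + 1) = E (k + 1) := by
      conv_rhs => rw [← update_eq_self i (E (k + 1)), hE]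
    rw [update_idem, update_self, h₄] at h₂
    have h₃ := testRight_runs x (E (k + 1)) (A (k + 1)) 0 false false i
    rw [hE] at h₃
    simpa using h₁.seq (h₂.seq h₃)
  · simp [hE]
  · rw [hE]
  · rfl

/-- Test whether both pointers are not at the beginning. -/
def testBoth (i j : Fin M) : Prog M :=
  .seq (testLeft i) (.peek (.lft j) fun v o => { v with go := v.go && o.isSome })

theorem testBoth_runs (i j : Fin M) (hi : e i ≤ x.length) (hj : e j ≤ x.length) :
    Runs (testBoth i j) 2 (conf x e A n b g) (conf x e A n b (0 < e i ∧ 0 < e j)) := by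
  refine (Runs.seq (testLeft_runs x e A n b g i hi) (Runs.peek.congr ?_)).mono le_rfl
  simp only [conf, cells_lft, Prod.mk.injEq, Ctl.mk.injEq, and_true, true_and]
  rw [Bool.eq_iff_iff]
  rcases x with _ | ⟨c, x⟩
  · simp at hi; simp [hi]
  · simp [Option.isSome_iff_ne_none, List.take_eq_nil_iff, Nat.pos_iff_ne_zero]

/-- Decide whether the pointer `i` is on the left of the pointer `j`. -/
def testLT (i j : Fin M) : Prog M :=
  .seq (testBoth i j) (.seq (.loop Ctl.go (.seq (left i) (.seq (left j)
    (.seq (.push .tmp fun _ => ()) (testBoth i j))))) (.seq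
  (.peek (.lft j) fun v o => { v with flag := o.isSome }) (.seq
  (.pop .tmp fun v o => { v with go := o.isSome }) (.loop Ctl.go (.seq (right i) (.seq (right j)
    (.pop .tmp fun v o => { v with go := o.isSome })))))))

/-- The pointers `i` and `j` moved to the left by `k`. -/
def back (i j : Fin M) (k : ℕ) : Fin M → ℕ := update (update e i (e i - k)) j (e j - k)

theorem back_zero (i j : Fin M) : back e i j 0 = e := by simp [back]

theorem back_left {i j : Fin M} (hij : i ≠ j) (k : ℕ) : back e i j k i = e i - k := by
  simp [back, hij]

theorem back_right (i j : Fin M) (k : ℕ) : back e i j k j = e j - k := by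
  simp [back]

theorem left_left_runs {i j : Fin M} (hij : i ≠ j) (hi : e i ≤ x.length) (hj : e j ≤ x.length)
    {k : ℕ} (hki : k < e i) (hkj : k < e j) :
    Runs ((left i).seq (left j)) 8 (conf x (back e i j k) A n b g)
      (conf x (back e i j (k + 1)) A n b g) := by
  have h₁ := left_runs x (update (update e i (e i - (k + 1))) j (e j - k)) A n b g i
    (by simp [hij]; omega)
  have h₂ := left_runs x (back e i j (k + 1)) A n b g j (by rw [back_right]; omega)
  rw [back_right, show e j - (k + 1) + 1 = e j - k by omega, back, update_idem] at h₂
  rw [update_of_ne hij, update_self, show e i - (k + 1) + 1 = e i - k by omega,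
    update_comm hij, update_idem] at h₁
  exact (h₁.congr₂ (by rw [update_comm hij.symm]; rfl) (by rw [update_comm hij.symm])).seq h₂

theorem right_right_runs {i j : Fin M} (hij : i ≠ j) (hi : e i ≤ x.length) (hj : e j ≤ x.length)
    {k : ℕ} (hki : k < e i) (hkj : k < e j) :
    Runs ((right i).seq (right j)) 8 (conf x (back e i j (k + 1)) A n b g)
      (conf x (back e i j k) A n b g) := by
  have h₁ := right_runs x (back e i j (k + 1)) A n b g i (by rw [back_left _ hij]; omega)
  have h₂ := right_runs x (update (update e i (e i - k)) j (e j - (k + 1))) A n b g j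
    (by simp; omega)
  rw [back_left _ hij, show e i - (k + 1) + 1 = e i - k by omega, back, update_comm hij.symm,
    update_idem] at h₁
  rw [update_self, update_idem, show e j - (k + 1) + 1 = e j - k by omega] at h₂
  exact h₁.seq h₂

theorem push_tmp_runs :
    Runs (.push .tmp fun _ => ()) 1 (conf x e A n b g) (conf x e A (n + 1) b g) :=
  Runs.push.congr (Prod.ext rfl (update_tmp _ _ _ _ _ _ (n + 1)))

theorem pop_tmp_runs :
    Runs (.pop .tmp fun v o => { v with go := o.isSome }) 1 (conf x e A n b g)
      (conf x e A (n - 1) b (0 < n)) := by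
  refine Runs.pop.congr (Prod.ext ?_ ?_)
  · rcases n with _ | n <;> simp [conf, List.replicate_succ]
  · simp only [conf, cells_tmp, List.tail_replicate]
    exact update_tmp ..

/-- Both pointers step left in parallel until one reaches the beginning, after `min (e i) (e j)`
steps. Then `j` is still away from the beginning exactly if `e i < e j`. The unary counter records
the steps and allows them to be undone. If the pointers coincided, each round would move the same
pointer twice. -/
theorem testLT_runs {i j : Fin M} (hij : i ≠ j) (hi : e i ≤ x.length) (hj : e j ≤ x.length) :
    Runs (testLT i j) (30 * x.length + 10) (conf x e A 0 b g)
      (conf x e A 0 (e i < e j) false) := by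
  obtain ⟨m, hm⟩ : ∃ m, m = min (e i) (e j) := ⟨_, rfl⟩
  have h₁ : Runs (testBoth i j) 2 (conf x e A 0 b g) (conf x e A 0 b (0 < e i ∧ 0 < e j)) :=
    testBoth_runs x e A 0 b g i j hi hj
  have h₂ := Runs.loop (T := 12) (p := .seq (left i) (.seq (left j)
      (.seq (.push .tmp fun _ => ()) (testBoth i j)))) (c := Ctl.go)
    (fun k => conf x (back e i j k) A k b (0 < e i - k ∧ 0 < e j - k)) m
    (by intro k hk; simp [conf]; omega) (by simp [conf]; omega)
    (by
      intro k hk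
      have h := left_left_runs x e A k b (0 < e i - k ∧ 0 < e j - k) hij hi hj (k := k)
        (by omega) (by omega)
      have h' := testBoth_runs x (back e i j (k + 1)) A (k + 1) b (0 < e i - k ∧ 0 < e j - k) i j
        (by rw [back_left _ hij]; omega) (by rw [back_right]; omega)
      rw [back_left _ hij, back_right] at h'
      exact ((h.seq ((push_tmp_runs ..).seq h')).assoc).mono (by omega))
  have h₃ : Runs (.peek (.lft j) fun v o => { v with flag := o.isSome }) 1
      (conf x (back e i j m) A m b false) (conf x (back e i j m) A m (e i < e j) false) := by
    refine Runs.peek.congr ?_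
    simp only [conf, cells_lft, Prod.mk.injEq, Ctl.mk.injEq, and_true]
    rw [Bool.eq_iff_iff, back_right]
    rcases x with _ | ⟨c, x⟩
    · simp at hi hj; simp [hi, hj]
    · simp [Option.isSome_iff_ne_none, List.take_eq_nil_iff]
      omega
  -- Every test of the loop condition pops a mark, including the one before the first round; so the
  -- counter is one below the number of remaining rounds.
  have h₄ := Runs.loop (T := 10) (p := .seq (right i) (.seq (right j)
    (.pop .tmp fun v o => { v with go := o.isSome }))) (c := Ctl.go)
    (fun k => conf x (back e i j (m - k)) A (m - k - 1) (e i < e j) (0 < m - k)) m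
    (by intro k hk; simp [conf]; omega) (by simp [conf])
    (by
      intro k hk
      have h := right_right_runs x e A (m - k - 1) (e i < e j) (0 < m - k) hij hi hj
        (k := m - (k + 1)) (by omega) (by omega)
      rw [show m - (k + 1) + 1 = m - k by omega] at h
      have h' := pop_tmp_runs x (back e i j (m - (k + 1))) A (m - k - 1) (e i < e j) (0 < m - k)
      exact ((h.seq h').assoc).mono (by omega))
  have h₅ := pop_tmp_runs x (back e i j m) A m (e i < e j) false
  rw [Nat.sub_self, back_zero] at h₄
  refine (h₁.seq ((h₂.congr₂ (by simp [back_zero]) (b' := conf x (back e i j m) A m b false)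
    ?_).seq (h₃.seq (h₅.seq (h₄.congr (by simp)))))).mono (by omega)
  congr 1
  simp; omega

/-- Decide whether the symbol at a pointer is `a`. -/
def testSym (i : Fin M) (a : CNFSymbol) : Prog M :=
  .peek (.rgt i) fun v o => { v with flag := o = some a, go := false }

theorem testSym_runs (i : Fin M) (a : CNFSymbol) :
    Runs (testSym i a) 1 (conf x e A 0 b g) (conf x e A 0 (x[e i]? = some a) false) := by
  refine Runs.peek.congr ?_
  simp [conf]

end PointerProg

open Classical in
/-- The number of `a < n` that satisfy `P`. -/
noncomputable def countBelow (n : ℕ) (P : ℕ → Prop) : ℕ := ((Finset.range n).filter P).card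

namespace PointerProg

open StackProg Function

/-! ### Definable predicates -/

section env

variable {M d s : ℕ}

theorem cons_lt (hs : s < M) {π : Fin d → Fin M} (hπ : ∀ i, (π i).1 < s) (i : Fin (d + 1)) :
    ((Fin.cons ⟨s, hs⟩ π : Fin (d + 1) → Fin M) i).1 < s + 1 := by
  refine Fin.cases ?_ (fun i => ?_) i
  · simp
  · simpa using (hπ i).trans (Nat.lt_succ_self s)

/-- The first scratch pointer becomes the newest variable. It is distinct from the pointers of the
old variables, which all lie below `s`. -/
theorem update_comp_cons (hs : s < M) {π : Fin d → Fin M} (hπ : ∀ i, (π i).1 < s)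
    (E : Fin M → ℕ) (v : ℕ) :
    update E ⟨s, hs⟩ v ∘ (Fin.cons ⟨s, hs⟩ π : Fin (d + 1) → Fin M) = Fin.cons v (E ∘ π) := by
  funext i
  refine Fin.cases ?_ (fun i => ?_) i
  · simp
  · have : π i ≠ ⟨s, hs⟩ := fun h => absurd (hπ i) (by rw [h]; simp)
    simp [this]

theorem update_le {n v : ℕ} {E : Fin M → ℕ} {c : Fin M} (hv : v ≤ n) (hE : ∀ i, E i ≤ n)
    (i : Fin M) : update E c v i ≤ n := by
  by_cases h : i = c
  · subst h; simpa
  · simpa [h] using hE i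

theorem update_zero {E : Fin M → ℕ} (hs : s < M) {v : ℕ} (h0 : ∀ i : Fin M, s ≤ i.1 → E i = 0)
    (i : Fin M) (hi : s + 1 ≤ i.1) : update E ⟨s, hs⟩ v i = 0 := by
  have : i ≠ ⟨s, hs⟩ := fun h => absurd hi (by rw [h]; simp)
  rw [update_of_ne this]
  exact h0 i (by omega)

end env

open Classical in
/-- A predicate on words and positions is definable if pointer programs that have sufficiently
many pointers can decide it in polynomial time. -/
def Definable {d : ℕ} (P : List CNFSymbol → (Fin d → ℕ) → Prop) : Prop :=
  ∃ (N : ℕ) (T : Polynomial ℕ), ∀ (M s : ℕ), s + N ≤ M → ∀ π : Fin d → Fin M,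
    (∀ i, (π i).1 < s) → ∃ p : Prog M, ∀ x E A b g, (∀ i, E i ≤ x.length) →
      (∀ i : Fin M, s ≤ i.1 → E i = 0) → Runs p (T.eval x.length) (conf x E A 0 b g)
        (conf x E A 0 (decide (P x (E ∘ π))) false)

/-- A function on words and positions is countable if pointer programs can add its value to a
pointer, up to the length of the word, in polynomial time. -/
def Countable {d : ℕ} (f : List CNFSymbol → (Fin d → ℕ) → ℕ) : Prop :=
  ∃ (N : ℕ) (T : Polynomial ℕ), ∀ (M s : ℕ), s + N ≤ M → ∀ π : Fin d → Fin M,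
    (∀ i, (π i).1 < s) → ∀ c : Fin M, c.1 < s → (∀ i, π i ≠ c) →
    ∃ p : Prog M, ∀ x E A b g, (∀ i, E i ≤ x.length) →
      (∀ i : Fin M, s ≤ i.1 → E i = 0) → Runs p (T.eval x.length) (conf x E A 0 b g)
        (conf x (update E c (min x.length (E c + f x (E ∘ π)))) A 0 false false)

/-- A word-valued function on words and positions is emittable if pointer programs can append its
value to the output in polynomial time. -/
def Emittable {d : ℕ} (f : List CNFSymbol → (Fin d → ℕ) → List ECCSymbol) : Prop :=
  ∃ (N : ℕ) (T : Polynomial ℕ), ∀ (M s : ℕ), s + N ≤ M → ∀ π : Fin d → Fin M,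
    (∀ i, (π i).1 < s) → ∃ p : Prog M, ∀ x E A b g, (∀ i, E i ≤ x.length) →
      (∀ i : Fin M, s ≤ i.1 → E i = 0) → Runs p (T.eval x.length) (conf x E A 0 b g)
        (conf x E ((f x (E ∘ π)).reverse ++ A) 0 false false)

theorem load_runs {M : ℕ} (x : List CNFSymbol) (e : Fin M → ℕ) (A : List ECCSymbol) (n : ℕ)
    (b g b' : Bool) :
    Runs (.load fun v => { v with flag := b', go := false }) 1 (conf x e A n b g)
      (conf x e A n b' false) := Runs.load

/-! ### Counting by summation over positions. -/

namespace Countable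

open Classical

variable {d : ℕ}

theorem indicator {P : List CNFSymbol → (Fin d → ℕ) → Prop} (hP : Definable P) :
    Countable fun x e => if P x e then 1 else 0 := by
  obtain ⟨N, T, hP⟩ := hP
  refine ⟨N, T + 6, fun M s hs π hπ c hc hc' => ?_⟩
  obtain ⟨p, hp⟩ := hP M s hs π hπ
  refine ⟨.seq p (.seq (.ite Ctl.flag (right c) (.load id))
    (.load fun v => { v with flag := false, go := false })), fun x E A b g hE h0 => ?_⟩
  rw [Polynomial.eval_add]
  refine Runs.mono ((hp x E A b g hE h0).seq (Runs.seq (T := 5) (T' := 1) ?_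
    (load_runs _ _ _ _ (decide (P x (E ∘ π))) false _))) (by simp)
  by_cases h : P x (E ∘ π)
  · refine Runs.ite_true (by simpa [conf] using h) ?_
    simp only [h, if_true]
    -- At the end of the word the move has no effect, in accordance with the truncated sum.
    rcases (hE c).lt_or_eq with hc | hc
    · rw [min_eq_right (by omega)]
      exact right_runs _ _ _ _ _ _ _ hc
    · rw [min_eq_left (by omega), ← hc, update_eq_self]
      exact right_runs_of_le _ _ _ _ _ _ _ (by omega)
  · refine (Runs.ite_false (by simpa [conf] using h) (Runs.load.congr ?_)).mono (by simp)
    simp only [h, if_false, add_zero, min_eq_right (hE c), update_eq_self]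
    rfl

/-- A loop over a fresh pointer, the summation variable, adds each summand to the same counter `c`.
-/
theorem sum {f : List CNFSymbol → (Fin (d + 1) → ℕ) → ℕ} (hf : Countable f) :
    Countable fun x e => ∑ a ∈ Finset.range x.length, f x (Fin.cons a e) := by
  obtain ⟨N, T, hf⟩ := hf
  refine ⟨N + 1, Polynomial.X * (T + 12) + 6, fun M s hs π hπ c hc hc' => ?_⟩
  have hsM : s < M := by omega
  have hcs : c ≠ ⟨s, hsM⟩ := fun h => absurd hc (by rw [h]; simp)
  obtain ⟨p, hp⟩ := hf M (s + 1) (by omega) (Fin.cons ⟨s, hsM⟩ π) (cons_lt hsM hπ) c (by omega)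
    (Fin.cases (by simpa using hcs.symm) (by simpa using hc'))
  refine ⟨forLoop ⟨s, hsM⟩ p, fun x E A b g hE h0 => ?_⟩
  let E' : ℕ → Fin M → ℕ := fun k =>
    update E c (min x.length (E c + ∑ a ∈ Finset.range k, f x (Fin.cons a (E ∘ π))))
  have hE' : ∀ k i, E' k i ≤ x.length := fun k => update_le (min_le_left _ _) hE
  have h0' : ∀ k (i : Fin M), s ≤ i.1 → E' k i = 0 := by
    intro k i hi
    have : i ≠ c := fun h => by rw [h] at hi; omega
    simpa [E', this] using h0 i hi
  have hEπ : ∀ k, E' k ∘ π = E ∘ π := by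
    intro k; funext i
    simp [E', hc' i]
  have key := forLoop_runs (x := x) (i := ⟨s, hsM⟩) (p := p) (T := T.eval x.length)
    (fun k => update (E' k) ⟨s, hsM⟩ k) (fun _ => A)
    (fun k => by simp) (fun k hk b g => by
      refine (hp x (update (E' k) ⟨s, hsM⟩ k) A b g (update_le hk.le (hE' k))
        (update_zero hsM (h0' k))).congr ?_
      rw [update_comp_cons hsM hπ, hEπ, update_idem, update_of_ne hcs, update_comm hcs.symm]
      congr 2
      -- Truncating after each summand gives the same result as truncating once at the end.
      simp only [E', update_self, update_idem, Finset.sum_range_succ]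
      congr 1
      omega) b g
  have h₀ : ∀ k, update (E' k) ⟨s, hsM⟩ 0 = E' k := by
    intro k
    rw [update_eq_self_iff, h0' k _ le_rfl]
  have h₁ : E' 0 = E := by simp [E', min_eq_right (hE c)]
  rw [update_idem, h₀, h₀, h₁] at key
  simpa using key

end Countable

/-! ### Closure of definability under connectives, quantifiers and counting. -/

namespace Definable

open Classical

variable {d : ℕ} {P Q : List CNFSymbol → (Fin d → ℕ) → Prop}

theorem congr (h : Definable P) (hPQ : ∀ x e, (∀ i, e i ≤ x.length) → (P x e ↔ Q x e)) :
    Definable Q := by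
  obtain ⟨N, T, h⟩ := h
  refine ⟨N, T, fun M s hs π hπ => ?_⟩
  obtain ⟨p, hp⟩ := h M s hs π hπ
  refine ⟨p, fun x E A b g hE h0 => ?_⟩
  refine (hp x E A b g hE h0).congr ?_
  congr 1
  exact decide_eq_decide.2 (hPQ x _ fun i => hE _)

theorem const (p : Prop) : Definable (d := d) fun _ _ => p := by
  refine ⟨0, 1, fun M s _ π _ =>
    ⟨.load fun v => { v with flag := p, go := false }, fun x e A b g _ _ => ?_⟩⟩
  simpa using load_runs x e A 0 b g _

theorem not (h : Definable P) : Definable fun x e => ¬ P x e := by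
  obtain ⟨N, T, h⟩ := h
  refine ⟨N, T + 1, fun M s hs π hπ => ?_⟩
  obtain ⟨p, hp⟩ := h M s hs π hπ
  refine ⟨.seq p (.load fun v => { v with flag := !v.flag }), fun x E A b g hE h0 => ?_⟩
  rw [Polynomial.eval_add, Polynomial.eval_one]
  refine (hp x E A b g hE h0).seq (Runs.load.congr ?_)
  simp [conf]

theorem and (hP : Definable P) (hQ : Definable Q) : Definable fun x e => P x e ∧ Q x e := by
  obtain ⟨N, T, hP⟩ := hP
  obtain ⟨N', T', hQ⟩ := hQ
  refine ⟨max N N', T + (T' + 2), fun M s hs π hπ => ?_⟩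
  obtain ⟨p, hp⟩ := hP M s (by omega) π hπ
  obtain ⟨q, hq⟩ := hQ M s (by omega) π hπ
  refine ⟨.seq p (.ite Ctl.flag q (.load id)), fun x E A b g hE h0 => ?_⟩
  rw [Polynomial.eval_add, Polynomial.eval_add]
  refine (hp x E A b g hE h0).seq ?_
  by_cases h : P x (E ∘ π)
  · refine ((Runs.ite_true (by simpa [conf] using h) (hq x E A _ _ hE h0)).congr ?_).mono
      (by simp)
    congr 1
    exact decide_eq_decide.2 (by simp [h])
  · exact ((Runs.ite_false (by simpa [conf] using h) Runs.load).congr (by simp [h]; rfl)).mono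
      (by simp)

theorem or (hP : Definable P) (hQ : Definable Q) : Definable fun x e => P x e ∨ Q x e :=
  (hP.not.and hQ.not).not.congr fun _ _ _ => by tauto

theorem imp (hP : Definable P) (hQ : Definable Q) : Definable fun x e => P x e → Q x e :=
  (hP.and hQ.not).not.congr fun _ _ _ => by tauto

theorem sym (i : Fin d) (a : CNFSymbol) : Definable fun x e => x[e i]? = some a := by
  refine ⟨0, 1, fun M s _ π _ => ⟨testSym (π i) a, fun x E A b g _ _ => ?_⟩⟩
  have := testSym_runs x E A b g (π i) a
  rw [Polynomial.eval_one]
  refine this.congr ?_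
  congr 1
  exact decide_eq_decide.2 Iff.rfl

theorem lt (i j : Fin d) : Definable fun _ e => e i < e j := by
  refine ⟨0, 30 * Polynomial.X + 10, fun M s _ π _ => ?_⟩
  by_cases hij : π i = π j
  · refine ⟨.load fun v => { v with flag := false, go := false }, fun x e A b g _ _ => ?_⟩
    exact ((load_runs x e A 0 b g _).congr (by simp [hij])).mono (by simp)
  · refine ⟨testLT (π i) (π j), fun x E A b g hE h0 => ?_⟩
    have := testLT_runs x E A b g hij (hE _) (hE _)
    refine (this.congr ?_).mono (by simp)
    congr 1
    exact decide_eq_decide.2 Iff.rfl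

theorem pos (i : Fin d) : Definable fun _ e => 0 < e i := by
  refine ⟨0, 2, fun M s _ π _ => ⟨.seq (testLeft (π i))
    (.load fun v => { v with flag := v.go, go := false }), fun x E A b g hE h0 => ?_⟩⟩
  have := testLeft_runs x E A 0 b g (π i) (hE _)
  refine ((this.seq Runs.load).congr ?_).mono (by simp)
  simp [conf]

/-- A predicate may refer to the value of a countable function as the newest variable. -/
theorem bind {f : List CNFSymbol → (Fin d → ℕ) → ℕ}
    {R : List CNFSymbol → (Fin (d + 1) → ℕ) → Prop}
    (hf : Countable f) (hR : Definable R) :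
    Definable fun x e => R x (Fin.cons (min x.length (f x e)) e) := by
  obtain ⟨N, T, hf⟩ := hf
  obtain ⟨N', T', hR⟩ := hR
  refine ⟨max N N' + 1, T + (T' + (6 * Polynomial.X + 2)), fun M s hs π hπ => ?_⟩
  have hsM : s < M := by omega
  obtain ⟨p, hp⟩ := hf M (s + 1) (by omega) π (fun i => (hπ i).trans (Nat.lt_succ_self s))
    ⟨s, hsM⟩ (by simp) (fun i h => absurd (hπ i) (by rw [h]; simp))
  obtain ⟨q, hq⟩ := hR M (s + 1) (by omega) (Fin.cons ⟨s, hsM⟩ π) (cons_lt hsM hπ)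
  refine ⟨.seq p (.seq q (rewind ⟨s, hsM⟩)), fun x E A b g hE h0 => ?_⟩
  have h₁ := hp x E A b g hE (fun i hi => h0 i (by omega))
  rw [h0 ⟨s, hsM⟩ le_rfl, zero_add] at h₁
  obtain ⟨v, hv⟩ : ∃ v, v = min x.length (f x (E ∘ π)) := ⟨_, rfl⟩
  rw [← hv] at h₁
  have h₂ := hq x (update E ⟨s, hsM⟩ v) A false false
    (update_le (hv.trans_le (min_le_left _ _)) hE) (update_zero hsM h0)
  have h₃ := rewind_runs x (update E ⟨s, hsM⟩ v) A 0
    (decide (R x (Fin.cons v (E ∘ π)))) false ⟨s, hsM⟩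
    (update_le (hv.trans_le (min_le_left _ _)) hE _)
  have h₀ : update E ⟨s, hsM⟩ 0 = E := by
    rw [update_eq_self_iff, h0 _ le_rfl]
  rw [update_idem, h₀] at h₃
  rw [update_comp_cons hsM hπ] at h₂
  simp only [Polynomial.eval_add, Polynomial.eval_mul, Polynomial.eval_X, Polynomial.eval_ofNat]
  exact (h₁.seq (h₂.seq h₃)).congr (by rw [hv])

/-- A witness exists exactly if the number of witnesses is positive; truncation at the length of the
word does not affect positivity, as a witness makes the word nonempty. -/
theorem ex {P : List CNFSymbol → (Fin (d + 1) → ℕ) → Prop} (hP : Definable P) :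
    Definable fun x e => ∃ a < x.length, P x (Fin.cons a e) := by
  refine (bind (Countable.indicator hP).sum (pos 0)).congr fun x e _ => ?_
  rw [Fin.cons_zero, lt_min_iff, Finset.sum_boole, Nat.cast_id, Finset.card_pos]
  constructor
  · rintro ⟨-, a, ha⟩
    exact ⟨a, by simpa using ha⟩
  · rintro ⟨a, ha, h⟩
    exact ⟨by omega, a, by simpa using ⟨ha, h⟩⟩

theorem all {P : List CNFSymbol → (Fin (d + 1) → ℕ) → Prop} (hP : Definable P) :
    Definable fun x e => ∀ a < x.length, P x (Fin.cons a e) :=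
  hP.not.ex.not.congr fun x e _ => by push Not; rfl

theorem le (i j : Fin d) : Definable fun _ e => e i ≤ e j :=
  (lt j i).not.congr fun _ _ _ => not_lt

theorem eq (i j : Fin d) : Definable fun _ e => e i = e j :=
  ((le i j).and (le j i)).congr fun _ _ _ => le_antisymm_iff.symm

/-- At most `x.length` positions are counted, so the truncation in `bind` does nothing. -/
theorem count {P : List CNFSymbol → (Fin (d + 1) → ℕ) → Prop} (hP : Definable P) (j : Fin d) :
    Definable fun x e => countBelow x.length (fun a => P x (Fin.cons a e)) = e j := by
  unfold countBelow
  refine (bind (Countable.indicator hP).sum (eq 0 j.succ)).congr fun x e _ => ?_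
  rw [Fin.cons_zero, Fin.cons_succ, Finset.sum_boole, Nat.cast_id, min_eq_right]
  exact (Finset.card_filter_le _ _).trans (by simp)

/-- The product is the number of pairs of positions below `e i` and `e j`, computed as a double sum.
It may exceed the length of the word, so the truncation remains visible. -/
theorem lt_mul (i j k : Fin d) : Definable fun x e => e k < min x.length (e i * e j) := by
  have h : Definable fun _ (e : Fin (d + 2) → ℕ) => e 0 < e j.succ.succ ∧ e 1 < e i.succ.succ :=
    (lt _ _).and (lt _ _)
  refine (bind (Countable.indicator h).sum.sum (lt k.succ 0)).congr fun x e he => ?_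
  have : ∑ a ∈ Finset.range x.length, ∑ b ∈ Finset.range x.length,
      (if b < e j ∧ a < e i then 1 else 0) = e i * e j := by
    rw [← Finset.sum_product', Finset.sum_boole, Nat.cast_id]
    rw [show ((Finset.range x.length ×ˢ Finset.range x.length).filter
      fun p => p.2 < e j ∧ p.1 < e i) = Finset.range (e i) ×ˢ Finset.range (e j) by
        ext ⟨a, b⟩
        have := he i
        have := he j
        simp only [Finset.mem_filter, Finset.mem_product, Finset.mem_range]
        omega]
    simp
  rw [Fin.cons_zero, Fin.cons_succ, ← this]
  -- Up to unfolding, the two double sums differ only in their decidability instances.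
  refine Iff.of_eq (congrArg (fun v => e k < min x.length v) ?_)
  exact Finset.sum_congr rfl fun a _ => Finset.sum_congr rfl fun b _ =>
    @ite_congr _ _ _ _ _ _ _ (_) (_) rfl (fun _ => rfl) (fun _ => rfl)

theorem forall_fintype {ι : Type*} [Finite ι] {P : ι → List CNFSymbol → (Fin d → ℕ) → Prop}
    (h : ∀ i, Definable (P i)) : Definable fun x e => ∀ i, P i x e := by
  have := Fintype.ofFinite ι
  have key : ∀ s : Finset ι, Definable fun x e => ∀ i ∈ s, P i x e := by
    intro s
    induction s using Finset.induction_on with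
    | empty => exact (const True).congr (by simp)
    | insert i s hi ih => exact ((h i).and ih).congr (by simp)
  exact (key Finset.univ).congr (by simp)

end Definable

end PointerProg

namespace PointerProg

open StackProg Function

theorem reverse_take_succ {α : Type*} {l : List α} {k : ℕ} (hk : k < l.length) :
    (l.take (k + 1)).reverse = l[k] :: (l.take k).reverse := by
  rw [List.take_succ_eq_append_getElem hk, List.reverse_append]; rfl

/-! ### Closure properties of emittable words. -/

namespace Emittable

open Classical

variable {d : ℕ} {f g : List CNFSymbol → (Fin d → ℕ) → List ECCSymbol}

theorem congr (hf : Emittable f) (h : ∀ x e, (∀ i, e i ≤ x.length) → f x e = g x e) :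
    Emittable g := by
  obtain ⟨N, T, hf⟩ := hf
  refine ⟨N, T, fun M s hs π hπ => ?_⟩
  obtain ⟨p, hp⟩ := hf M s hs π hπ
  exact ⟨p, fun x E A b g hE h0 => h x (E ∘ π) (fun i => hE _) ▸ hp x E A b g hE h0⟩

theorem nil : Emittable (d := d) fun _ _ => [] :=
  ⟨0, 1, fun M s hs π hπ => ⟨.load fun v => { v with flag := false, go := false },
    fun x e A b g _ _ => by simpa using load_runs x e A 0 b g _⟩⟩

theorem singleton (a : ECCSymbol) : Emittable (d := d) fun _ _ => [a] :=
  ⟨0, 1 + 1, fun M s hs π hπ => ⟨.seq (.push .acc fun _ => a)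
    (.load fun v => { v with flag := false, go := false }), fun x e A b g _ _ => by
      rw [Polynomial.eval_add, Polynomial.eval_one]
      exact (Runs.push.congr (by simp [conf])).seq (load_runs x e (a :: A) 0 b g _)⟩⟩

theorem append (hf : Emittable f) (hg : Emittable g) : Emittable fun x e => f x e ++ g x e := by
  obtain ⟨N, T, hf⟩ := hf
  obtain ⟨N', T', hg⟩ := hg
  refine ⟨max N N', T + T', fun M s hs π hπ => ?_⟩
  obtain ⟨p, hp⟩ := hf M s (by omega) π hπ
  obtain ⟨q, hq⟩ := hg M s (by omega) π hπ
  refine ⟨.seq p q, fun x E A b g hE h0 => ?_⟩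
  rw [Polynomial.eval_add]
  exact (hp x E A b g hE h0).seq ((hq x E _ _ _ hE h0).congr (by simp))

theorem ite {P : List CNFSymbol → (Fin d → ℕ) → Prop} (hP : Definable P) (hf : Emittable f)
    (hg : Emittable g) : Emittable fun x e => if P x e then f x e else g x e := by
  obtain ⟨N, T, hf⟩ := hf
  obtain ⟨N', T', hg⟩ := hg
  obtain ⟨N'', T'', hP⟩ := hP
  refine ⟨max N'' (max N N'), T'' + (T + T' + 1), fun M s hs π hπ => ?_⟩
  obtain ⟨p, hp⟩ := hf M s (by omega) π hπ
  obtain ⟨q, hq⟩ := hg M s (by omega) π hπ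
  obtain ⟨r, hr⟩ := hP M s (by omega) π hπ
  refine ⟨.seq r (.ite Ctl.flag p q), fun x E A b g hE h0 => ?_⟩
  simp only [Polynomial.eval_add, Polynomial.eval_one]
  refine (hr x E A b g hE h0).seq ?_
  by_cases h : P x (E ∘ π)
  · simp only [h, if_true]
    exact (Runs.ite_true (by simp [conf]) (hp x E A _ _ hE h0)).mono (by omega)
  · simp only [h, if_false]
    exact (Runs.ite_false (by simp [conf]) (hq x E A _ _ hE h0)).mono (by omega)

theorem flatMap {ι : Type*} {f : ι → List CNFSymbol → (Fin d → ℕ) → List ECCSymbol} (l : List ι)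
    (hf : ∀ i ∈ l, Emittable (f i)) : Emittable fun x e => l.flatMap fun i => f i x e := by
  induction l with
  | nil => exact nil
  | cons i l ih =>
    simp only [List.flatMap_cons]
    exact (hf i (by simp)).append (ih fun j hj => hf j (by simp [hj]))

theorem range_flatMap {f : List CNFSymbol → (Fin (d + 1) → ℕ) → List ECCSymbol}
    (hf : Emittable f) :
    Emittable fun x e => (List.range x.length).flatMap fun a => f x (Fin.cons a e) := by
  obtain ⟨N, T, hf⟩ := hf
  refine ⟨N + 1, Polynomial.X * (T + 12) + 6, fun M s hs π hπ => ?_⟩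
  have hsM : s < M := by omega
  obtain ⟨p, hp⟩ := hf M (s + 1) (by omega) (Fin.cons ⟨s, hsM⟩ π) (cons_lt hsM hπ)
  refine ⟨forLoop ⟨s, hsM⟩ p, fun x E A b g hE h0 => ?_⟩
  have key := forLoop_runs (x := x) (i := ⟨s, hsM⟩) (p := p) (T := T.eval x.length)
    (fun k => update E ⟨s, hsM⟩ k)
    (fun k => ((List.range k).flatMap fun a => f x (Fin.cons a (E ∘ π))).reverse ++ A)
    (fun k => by simp) (fun k hk b g => by
      refine (hp x (update E ⟨s, hsM⟩ k) _ b g (update_le hk.le hE) (update_zero hsM h0)).congr ?_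
      rw [update_comp_cons hsM hπ, update_idem]
      simp [List.range_succ]) b g
  have h₀ : update E ⟨s, hsM⟩ 0 = E := by rw [update_eq_self_iff, h0 _ le_rfl]
  rw [update_idem, h₀] at key
  simpa using key

end Emittable

/-! ### Input and output of pointer programs -/

variable {M : ℕ}

/-- Push the symbol in the source register to the left stacks of all pointers in `l`. -/
def pushAll : List (Fin M) → Prog M
  | [] => .load id
  | i :: l => .seq (.push (.lft i) fun v => v.src.getD .clause) (pushAll l)

theorem pushAll_runs {l : List (Fin M)} (hl : l.Nodup) (v : Ctl) (I : List CNFSymbol)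
    (O : List ECCSymbol) (n : ℕ) (A : List ECCSymbol) (L R : Fin M → List CNFSymbol) :
    Runs (pushAll l) (l.length + 1) (v, cells I O n A L R)
      (v, cells I O n A (fun i => if i ∈ l then v.src.getD .clause :: L i else L i) R) := by
  induction l generalizing L with
  | nil => exact (Runs.load.congr (by simp)).mono (by simp)
  | cons i l ih =>
    refine ((Runs.push.congr (by rw [cells_lft, update_lft])).seq
      ((ih hl.of_cons _).congr ?_)).mono (by simp; omega)
    congr 2
    funext j
    have hi : i ∉ l := (List.nodup_cons.1 hl).1
    by_cases hj : j = i
    · subst hj; simp [hi]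
    · simp [hj]

/-- Read the input and copy it to all pointers. -/
def readInput (M : ℕ) : Prog M :=
  .seq (.pop .inp fun v o => { v with go := o.isSome, src := o })
    (.loop Ctl.go (.seq (pushAll (List.finRange M))
      (.pop .inp fun v o => { v with go := o.isSome, src := o })))

theorem readInput_runs (x : List CNFSymbol) :
    Runs (readInput M) (x.length * (M + 3) + 2)
      (⟨false, false, none, none⟩, cells x [] 0 [] (fun _ => []) (fun _ => []))
      (conf x (fun _ => x.length) [] 0 false false) := by
  -- After `k` rounds the symbol number `k` is already in the register, so the input stack starts
  -- with the following one. In the end all pointers stand at the right end.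
  let s : ℕ → PState M := fun k => (⟨false, x[k]?.isSome, x[k]?, none⟩,
    cells (x.drop (k + 1)) [] 0 [] (fun _ => (x.take k).reverse) (fun _ => []))
  have h := Runs.loop (T := M + 2) (c := Ctl.go) (p := .seq (pushAll (List.finRange M))
      (.pop .inp fun v o => { v with go := o.isSome, src := o })) s x.length
      (by intro i hi; simp [s, hi]) (by simp [s]) (by
        intro k hk
        refine ((pushAll_runs (List.nodup_finRange M) _ _ _ _ _ _ _).seq
          (Runs.pop.congr ?_)).mono (by simp)
        simp [s, reverse_take_succ hk, hk])
  refine (Runs.seq Runs.pop (h.congr₂ ?_ ?_)).mono (by ring_nf; omega)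
  · simp [s, ← List.head?_eq_getElem?]
  · simp [s, conf, List.drop_eq_nil_of_le]

/-- Move all pointers in `l` to the beginning. -/
def rewindAll : List (Fin M) → Prog M
  | [] => .load fun v => { v with flag := false, go := false }
  | i :: l => .seq (rewind i) (rewindAll l)

theorem rewindAll_runs (l : List (Fin M)) (x : List CNFSymbol) (e : Fin M → ℕ)
    (he : ∀ i, e i ≤ x.length) (A : List ECCSymbol) (b g : Bool) :
    Runs (rewindAll l) (l.length * (6 * x.length + 2) + 1) (conf x e A 0 b g)
      (conf x (fun i => if i ∈ l then 0 else e i) A 0 false false) := by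
  induction l generalizing e b g with
  | nil => exact ((load_runs x e A 0 b g false).congr (by simp)).mono (by simp)
  | cons i l ih =>
    refine ((rewind_runs x e A 0 b g i (he i)).seq ((ih (update e i 0) ?_ b false).congr ?_)).mono
      (by simp only [List.length_cons]; ring_nf; omega)
    · intro j
      by_cases hj : j = i
      · subst hj; simp
      · simpa [hj] using he j
    · congr 1
      funext j
      by_cases hj : j = i
      · subst hj; simp
      · simp [hj]

/-- Move the output from the auxiliary stack to the output stack. -/
def writeOutput (M : ℕ) : Prog M :=
  .seq (.pop .acc fun v o => { v with go := o.isSome, dst := o })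
    (.loop Ctl.go (.seq (.push .out fun v => v.dst.getD .row)
      (.pop .acc fun v o => { v with go := o.isSome, dst := o })))

theorem writeOutput_runs (A : List ECCSymbol) (L R : Fin M → List CNFSymbol) :
    Runs (writeOutput M) (A.length * 3 + 2) (⟨false, false, none, none⟩, cells [] [] 0 A L R)
      (⟨false, false, none, none⟩, cells [] A.reverse 0 [] L R) := by
  let s : ℕ → PState M := fun k => (⟨false, A[k]?.isSome, none, A[k]?⟩,
    cells [] (A.take k).reverse 0 (A.drop (k + 1)) L R)
  have h := Runs.loop (T := 2) (c := Ctl.go) (p := .seq (.push .out fun v => v.dst.getD .row)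
      (.pop .acc fun v o => { v with go := o.isSome, dst := o })) s A.length
      (by intro i hi; simp [s, hi]) (by simp [s]) (by
        intro k hk
        refine (Runs.push.seq (Runs.pop.congr ?_)).mono (by simp)
        simp [s, reverse_take_succ hk, hk])
  refine (Runs.seq Runs.pop (h.congr₂ ?_ ?_)).mono (by omega)
  · simp [s, ← List.head?_eq_getElem?]
  · simp [s, List.drop_eq_nil_of_le]

/-- Remove all symbols on the right of a pointer. -/
def clear (i : Fin M) : Prog M :=
  .seq (.pop (.rgt i) fun v o => { v with go := o.isSome })
    (.loop Ctl.go (.pop (.rgt i) fun v o => { v with go := o.isSome }))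

theorem clear_runs (i : Fin M) (I : List CNFSymbol)
    (O : List ECCSymbol) (n : ℕ) (A : List ECCSymbol) (L R : Fin M → List CNFSymbol) :
    Runs (clear i) ((R i).length * 2 + 2) (⟨false, false, none, none⟩, cells I O n A L R)
      (⟨false, false, none, none⟩, cells I O n A L (update R i [])) := by
  let s : ℕ → PState M := fun k => (⟨false, (R i)[k]?.isSome, none, none⟩,
    cells I O n A L (update R i ((R i).drop (k + 1))))
  have h := Runs.loop (T := 1) (c := Ctl.go)
      (p := .pop (.rgt i) fun v o => { v with go := o.isSome }) s (R i).length
      (by intro i hi; simp [s, hi]) (by simp [s]) (by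
        intro k hk
        refine Runs.pop.congr ?_
        simp [s])
  refine (Runs.seq Runs.pop (h.congr₂ ?_ ?_)).mono (by omega)
  · simp [s, ← List.head?_eq_getElem?]
  · simp [s, List.drop_eq_nil_of_le]

/-- Remove all symbols on the right of the pointers in `l`. -/
def clearAll : List (Fin M) → Prog M
  | [] => .load id
  | i :: l => .seq (clear i) (clearAll l)

theorem clearAll_runs (l : List (Fin M)) (I : List CNFSymbol)
    (O : List ECCSymbol) (n : ℕ) (A : List ECCSymbol) (L R : Fin M → List CNFSymbol) (B : ℕ)
    (hB : ∀ i, (R i).length ≤ B) :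
    Runs (clearAll l) (l.length * (B * 2 + 2) + 1) (⟨false, false, none, none⟩, cells I O n A L R)
      (⟨false, false, none, none⟩, cells I O n A L (fun i => if i ∈ l then [] else R i)) := by
  induction l generalizing R with
  | nil => exact (Runs.load.congr (by simp)).mono (by simp)
  | cons i l ih =>
    refine ((clear_runs i I O n A L R).seq ((ih (update R i []) ?_).congr ?_)).mono ?_
    · intro j
      by_cases hj : j = i
      · subst hj; simp
      · simpa [hj] using hB j
    · congr 2
      funext j
      by_cases hj : j = i
      · subst hj; simp
      · simp [hj]
    · have := hB i
      simp only [List.length_cons]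
      ring_nf
      omega

/-- The length of the output of a program is bounded by its running time. -/
theorem _root_.StackProg.Exec.acc_length_le {p : Prog M} {t : ℕ} {a b : PState M}
    (h : Exec p t a b) : (b.2 .acc).length ≤ (a.2 .acc).length + t := by
  induction h with
  | push k f v S =>
    by_cases hk : k = .acc
    · subst hk; simp
    · simp [Ne.symm hk]
  | pop k f v S =>
    by_cases hk : k = .acc
    · subst hk; simp; omega
    · simp [Ne.symm hk]
  | peek | load => simp
  | seq _ _ h₁ h₂ => omega
  | ite_true _ _ h | ite_false _ _ h => omega
  | loop_done => omega
  | loop_step _ _ _ h₁ h₂ => omega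

/-- No variables are free, so all pointers are scratch pointers. The output is collected in reverse
and turned around at the end. A halting configuration must have all stacks but the output empty: the
pointers have returned to the beginning, so only their right stacks need clearing. -/
theorem tm2ComputableInPolyTime_of_emittable {α β : Type} {ea : α → List CNFSymbol}
    {eb : β → List ECCSymbol} {F : α → β}
    {f : List CNFSymbol → (Fin 0 → ℕ) → List ECCSymbol} (hf : Emittable f)
    (h : ∀ a, f (ea a) Fin.elim0 = eb (F a)) :
    Nonempty (Turing.TM2ComputableInPolyTime ea eb F) := by
  obtain ⟨M, T, hf⟩ := hf
  obtain ⟨p, hp⟩ := hf M 0 (by omega) Fin.elim0 fun i => i.elim0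
  refine StackProg.tm2ComputableInPolyTime (Γ := Stk.Alph (M := M)) Stk.inp Stk.out
    (Equiv.refl CNFSymbol) (Equiv.refl ECCSymbol) (⟨false, false, none, none⟩ : Ctl)
    (.seq (readInput M) (.seq (rewindAll (List.finRange M)) (.seq p (.seq (writeOutput M)
      (clearAll (List.finRange M))))))
    ((Polynomial.X * ((M : Polynomial ℕ) + 3) + 2) +
      (((M : Polynomial ℕ) * (6 * Polynomial.X + 2) + 1) + (T +
      ((T * 3 + 2) + ((M : Polynomial ℕ) * (Polynomial.X * 2 + 2) + 1))))) fun a => ?_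
  have h₀ := h a
  generalize eb (F a) = y at h₀ ⊢
  generalize ea a = x at h₀ ⊢
  have h₁ := readInput_runs (M := M) x
  have h₂ := rewindAll_runs (List.finRange M) x (fun _ => x.length) (fun _ => le_rfl) [] false false
  have h₃ := hp x (fun _ => 0) [] false false (by simp) (by simp)
  have h₄ := writeOutput_runs y.reverse (fun _ : Fin M => (x.take 0).reverse) (fun _ => x.drop 0)
  have h₅ := clearAll_runs (List.finRange M) [] y 0 [] (fun _ => (x.take 0).reverse)
    (fun _ => x.drop 0) x.length (by simp)
  rw [show (fun _ => 0) ∘ (Fin.elim0 : Fin 0 → Fin M) = Fin.elim0 from funext fun i => i.elim0,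
    h₀] at h₃
  -- At most one symbol is written per step; hence `T` also bounds the cost of copying the output.
  have hy : y.length ≤ T.eval x.length := by
    obtain ⟨t, ht, h₃⟩ := h₃
    have := h₃.acc_length_le
    simp [conf] at this
    omega
  have hi : update (β := fun k : Stk M => List k.Alph) (fun _ => []) .inp x =
      cells x [] 0 [] (fun _ => []) (fun _ => []) := by
    rw [show (fun _ => [] : ∀ k : Stk M, List k.Alph) =
      cells [] [] 0 [] (fun _ => []) (fun _ => []) by funext k; cases k <;> rfl, update_inp]
  have ho : update (β := fun k : Stk M => List k.Alph) (fun _ => []) .out y =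
      cells [] y 0 [] (fun _ => []) (fun _ => []) := by
    rw [show (fun _ => [] : ∀ k : Stk M, List k.Alph) =
      cells [] [] 0 [] (fun _ => []) (fun _ => []) by funext k; cases k <;> rfl, update_out]
  simp only [Equiv.refl_symm, Equiv.coe_refl, List.map_id]
  rw [hi, ho]
  refine (h₁.seq (h₂.seq ((h₃.congr₂ (by simp) rfl).seq ((h₄.congr₂ (by simp [conf]) rfl).seq
    (h₅.congr₂ (by simp) (by simp)))))).mono ?_
  simp only [Polynomial.eval_add, Polynomial.eval_mul, Polynomial.eval_X, Polynomial.eval_one,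
    Polynomial.eval_ofNat, Polynomial.eval_natCast, Nat.cast_id, List.length_reverse,
    List.length_finRange]
  gcongr

end PointerProg

/-! ### The graph of a formula -/

/-- The kinds of vertices that have to be covered by few cliques: the two truth values, two
further colors, the literals, and three vertices for each clause. -/
inductive WKind : Type
  | fls
  | tru
  | extra (b : Bool)
  | var (b : Bool)
  | cl (r : Fin 3)
  deriving Fintype

/-- The features that separate vertices that may be joined. -/
inductive Feat : Type
  | all (τ : WKind)
  | varBit (b β : Bool)
  | missing (r r' : Fin 3)
  | sign (r r' : Fin 3) (b : Bool)
  | clBit (r r' : Fin 3) (β : Bool)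
  deriving Fintype

/-- The kinds of vertices of the graph. -/
inductive VKind : Type
  | hub
  | w (τ : WKind)
  | guard (i : Feat × Feat) (b : Bool)
  deriving Fintype

/-- A formula whose variables and clauses are located at certain positions, together with a
binary code for the variables, whose digits are located at certain positions as well. -/
structure ClauseSystem where
  Name : Type
  Nonempty : Prop
  IsVar : ℕ → Prop
  IsClause : ℕ → Prop
  name : ℕ → Name
  slot : ℕ → Fin 3 → Option (Name × Bool)
  guards : Finset ℕ
  bit : ℕ → Name → Bool
  nonempty_of_isClause : ∀ {p}, IsClause p → Nonempty
  nonempty_of_isVar : ∀ {i}, IsVar i → Nonempty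
  guards_nonempty : Nonempty → guards.Nonempty
  name_inj : ∀ {i j}, IsVar i → IsVar j → name i = name j → i = j
  exists_var : ∀ {p r a b}, IsClause p → slot p r = some (a, b) → ∃ i, IsVar i ∧ name i = a
  separated : ∀ {i j}, IsVar i → IsVar j → i ≠ j → ∃ q ∈ guards, bit q (name i) ≠ bit q (name j)

namespace ClauseSystem

variable (S : ClauseSystem)

/-- The formula is satisfiable. -/
def Sat : Prop :=
  ∃ f : S.Name → Bool, ∀ p, S.IsClause p → ∃ r a b, S.slot p r = some (a, b) ∧ f a = b

/-- The positions of the vertices of each kind. -/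
def IsW : WKind → ℕ → Prop
  | .fls, p | .tru, p | .extra _, p => p = 0 ∧ S.Nonempty
  | .var _, p => S.IsVar p
  | .cl _, p => S.IsClause p

/-- The pairs of vertices that may not be in the same clique. -/
def Clash : WKind → ℕ → WKind → ℕ → Prop
  | .fls, _, .tru, _ | .fls, _, .extra _, _ | .fls, _, .cl _, _ => True
  | .tru, _, .extra _, _ | .extra _, _, .extra _, _ | .var _, _, .extra _, _ => True
  | .var _, i, .var _, j => i = j
  | .cl r, p, .tru, _ => S.slot p r = none
  | .cl r, p, .var b, i => S.slot p r = some (S.name i, !b)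
  | .cl r, p, .cl r', p' => r ≠ r' ∧ ∀ r'', S.slot p r'' = S.slot p' r''
  | _, _, _, _ => False

/-- The vertices that have a feature. -/
def HasFeat (q : ℕ) : Feat → WKind → ℕ → Prop
  | .all τ, τ', _ => τ' = τ
  | .varBit b β, τ', p => τ' = .var b ∧ S.bit q (S.name p) = β
  | .missing r r', τ', p => τ' = .cl r ∧ S.slot p r' = none
  | .sign r r' b, τ', p => τ' = .cl r ∧ ∃ a, S.slot p r' = some (a, b)
  | .clBit r r' β, τ', p => τ' = .cl r ∧ ∃ a b, S.slot p r' = some (a, b) ∧ S.bit q a = β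

/-- The vertices that have one of two features. -/
def InPair (i : Feat × Feat) (q : ℕ) (τ : WKind) (p : ℕ) : Prop :=
  S.HasFeat q i.1 τ p ∨ S.HasFeat q i.2 τ p

/-- The vertices that have one of two features do not clash. -/
def Good (i : Feat × Feat) (q : ℕ) : Prop :=
  ∀ τ τ' p p', S.IsW τ p → S.IsW τ' p' → S.InPair i q τ p → S.InPair i q τ' p' →
    (τ, p) ≠ (τ', p') → ¬ S.Clash τ p τ' p'

/-- The kind of the vertices that have a feature. -/
def _root_.Feat.kind : Feat → WKind
  | .all τ => τ
  | .varBit b _ => .var b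
  | .missing r _ | .sign r _ _ | .clBit r _ _ => .cl r

/-! ### Separating non-clashing vertices by features. -/

variable {S}

theorem HasFeat.kind_eq {q : ℕ} {F : Feat} {τ : WKind} {p : ℕ} (h : S.HasFeat q F τ p) :
    τ = F.kind := by
  cases F
  · exact h
  all_goals exact h.1

theorem not_clash_self {τ : WKind} {p p' : ℕ} (h : S.IsW τ p) (h' : S.IsW τ p') (hp : p ≠ p') :
    ¬ S.Clash τ p τ p' := by
  cases τ with
  | fls | tru | extra => exact absurd (h.1.trans h'.1.symm) hp
  | var => exact hp
  | cl => exact fun h => h.1 rfl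

/-- The bearers of one feature have the same kind, and distinct vertices of the same kind never
clash. So only a bearer of `F` and a bearer of `F'` have to be compared. -/
theorem good_of_cross {F F' : Feat} {q : ℕ}
    (h : ∀ τ τ' p p', S.IsW τ p → S.IsW τ' p' → S.HasFeat q F τ p → S.HasFeat q F' τ' p' →
      (τ, p) ≠ (τ', p') → ¬ S.Clash τ p τ' p' ∧ ¬ S.Clash τ' p' τ p) : S.Good (F, F') q := by
  have same : ∀ F τ τ' p p', S.IsW τ p → S.IsW τ' p' → S.HasFeat q F τ p →
      S.HasFeat q F τ' p' → (τ, p) ≠ (τ', p') → ¬ S.Clash τ p τ' p' := by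
    intro F τ τ' p p' hp hp' hF hF' hne
    obtain rfl : τ = τ' := hF.kind_eq.trans hF'.kind_eq.symm
    exact not_clash_self hp hp' fun h => hne (by rw [h])
  rintro τ τ' p p' hp hp' (hF | hF) (hF' | hF') hne
  · exact same F _ _ _ _ hp hp' hF hF' hne
  · exact (h _ _ _ _ hp hp' hF hF' hne).1
  · exact (h _ _ _ _ hp' hp hF' hF hne.symm).2
  · exact same F' _ _ _ _ hp hp' hF hF' hne

variable (S) in
/-- The two vertices belong to a clique that is fixed in advance. -/
def Covered (τ : WKind) (p : ℕ) (τ' : WKind) (p' : ℕ) : Prop :=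
  ∃ i, ∃ q ∈ S.guards, S.Good i q ∧ S.InPair i q τ p ∧ S.InPair i q τ' p'

theorem Covered.symm {τ τ' : WKind} {p p' : ℕ} (h : S.Covered τ p τ' p') :
    S.Covered τ' p' τ p :=
  let ⟨i, q, hq, hg, h, h'⟩ := h
  ⟨i, q, hq, hg, h', h⟩

theorem IsW.nonempty {τ : WKind} {p : ℕ} (h : S.IsW τ p) : S.Nonempty := by
  cases τ with
  | fls | tru | extra => exact h.2
  | var => exact S.nonempty_of_isVar h
  | cl => exact S.nonempty_of_isClause h

/-- The features must exclude a clash between any two of their bearers, not only between the two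
given vertices; this makes the clique independent of the pair that it is to cover. -/
theorem covered_of_cross {F F' : Feat} {q : ℕ} {τ τ' : WKind} {p p' : ℕ} (hq : q ∈ S.guards)
    (hp : S.HasFeat q F τ p) (hp' : S.HasFeat q F' τ' p')
    (h : ∀ p p', S.IsW F.kind p → S.IsW F'.kind p' → S.HasFeat q F F.kind p →
      S.HasFeat q F' F'.kind p' → (F.kind, p) ≠ (F'.kind, p') →
      ¬ S.Clash F.kind p F'.kind p' ∧ ¬ S.Clash F'.kind p' F.kind p) : S.Covered τ p τ' p' := by
  refine ⟨(F, F'), q, hq, good_of_cross ?_, Or.inl hp, Or.inr hp'⟩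
  intro τ τ' p p' hp hp' hF hF' hne
  obtain rfl := hF.kind_eq
  obtain rfl := hF'.kind_eq
  exact h p p' hp hp' hF hF' hne

theorem covered_of_kinds {τ τ' : WKind} {p p' : ℕ} (hne : S.Nonempty)
    (h : ∀ p p', S.IsW τ p → S.IsW τ' p' → (τ, p) ≠ (τ', p') →
      ¬ S.Clash τ p τ' p' ∧ ¬ S.Clash τ' p' τ p) : S.Covered τ p τ' p' := by
  obtain ⟨q, hq⟩ := S.guards_nonempty hne
  exact covered_of_cross (F := .all τ) (F' := .all τ') hq rfl rfl
    fun p p' hp hp' _ _ hne => h p p' hp hp' hne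

theorem covered_self {τ : WKind} {p p' : ℕ} (hne : S.Nonempty) : S.Covered τ p τ p' :=
  covered_of_kinds hne fun p p' hp hp' hne => by
    have : p ≠ p' := fun h => hne (by rw [h])
    exact ⟨not_clash_self hp hp' this, not_clash_self hp' hp this.symm⟩

/-- Literals of one variable agree in every digit. Prescribing different values of one digit on the
two sides therefore excludes clashes. -/
theorem covered_var_var {b b' : Bool} {i j : ℕ} (hi : S.IsVar i) (hj : S.IsVar j) (hij : i ≠ j) :
    S.Covered (.var b) i (.var b') j := by
  obtain ⟨q, hq, h⟩ := S.separated hi hj hij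
  refine covered_of_cross (F := .varBit b (S.bit q (S.name i)))
    (F' := .varBit b' (S.bit q (S.name j))) hq ⟨rfl, rfl⟩ ⟨rfl, rfl⟩ ?_
  rintro p p' - - ⟨-, hp⟩ ⟨-, hp'⟩ -
  constructor
  · rintro rfl
    exact h (hp.symm.trans hp')
  · rintro rfl
    exact h (hp.symm.trans hp')

theorem covered_cl_tru {r : Fin 3} {p p' : ℕ} (hne : S.Nonempty) (h : S.slot p r ≠ none) :
    S.Covered (.cl r) p .tru p' := by
  obtain ⟨q, hq⟩ := S.guards_nonempty hne
  obtain ⟨⟨a, b⟩, hab⟩ := Option.ne_none_iff_exists'.1 h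
  refine covered_of_cross (F := .sign r r b) (F' := .all .tru) hq ⟨rfl, a, hab⟩ rfl ?_
  rintro p p' - - ⟨-, a, hp⟩ - -
  exact ⟨fun h : S.slot p r = none => by simp [h] at hp, id⟩

/-- There are three reasons not to clash: the slot is empty, its sign is not the opposite one, or
its variable differs from `i` in some digit. Each is a feature that excludes all clashes. -/
theorem covered_cl_var {r : Fin 3} {b : Bool} {p i : ℕ} (hp : S.IsClause p) (hi : S.IsVar i)
    (h : S.slot p r ≠ some (S.name i, !b)) : S.Covered (.cl r) p (.var b) i := by
  obtain ⟨q, hq⟩ := S.guards_nonempty (S.nonempty_of_isClause hp)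
  rcases hs : S.slot p r with _ | ⟨a, c⟩
  · refine covered_of_cross (F := .missing r r) (F' := .all (.var b)) hq ⟨rfl, hs⟩ rfl ?_
    rintro p j - - ⟨-, hp⟩ - -
    exact ⟨fun h : S.slot p r = _ => by simp [h] at hp, id⟩
  by_cases hc : c = !b
  · obtain ⟨j, hj, rfl⟩ := S.exists_var hp hs
    have hij : i ≠ j := by
      rintro rfl
      exact h (by rw [hs, hc])
    obtain ⟨q, hq, hb⟩ := S.separated hi hj hij
    refine covered_of_cross (F := .clBit r r (S.bit q (S.name j)))
      (F' := .varBit b (S.bit q (S.name i))) hq ⟨rfl, _, _, hs, rfl⟩ ⟨rfl, rfl⟩ ?_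
    rintro p k - - ⟨-, a, c, hp, ha⟩ ⟨-, hk⟩ -
    refine ⟨fun h : S.slot p r = _ => ?_, id⟩
    rw [h] at hp
    cases hp
    exact hb (hk.symm.trans ha)
  · refine covered_of_cross (F := .sign r r c) (F' := .all (.var b)) hq ⟨rfl, _, hs⟩ rfl ?_
    rintro p j - - ⟨-, a, hp⟩ - -
    refine ⟨fun h : S.slot p r = _ => ?_, id⟩
    rw [h] at hp
    cases hp
    exact hc rfl

/-- Slots can differ because just one of them is empty, in their signs, or in a digit of their
variables. Features recording such a difference at `r''` exclude equality of the clauses. -/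
theorem covered_cl_cl {r r' r'' : Fin 3} {p p' : ℕ} (hp : S.IsClause p)
    (hp' : S.IsClause p') (h : S.slot p r'' ≠ S.slot p' r'') :
    S.Covered (.cl r) p (.cl r') p' := by
  obtain ⟨q, hq⟩ := S.guards_nonempty (S.nonempty_of_isClause hp)
  have key : ∀ {F F' : Feat} {q : ℕ}, q ∈ S.guards → F.kind = .cl r → F'.kind = .cl r' →
      S.HasFeat q F (.cl r) p → S.HasFeat q F' (.cl r') p' →
      (∀ p p', S.HasFeat q F (.cl r) p → S.HasFeat q F' (.cl r') p' →
        S.slot p r'' ≠ S.slot p' r'') → S.Covered (.cl r) p (.cl r') p' := by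
    intro F F' q hq hF hF' h₁ h₂ h
    refine covered_of_cross hq h₁ h₂ ?_
    rw [hF, hF']
    intro p p' _ _ h₁ h₂ _
    exact ⟨fun hc => h p p' h₁ h₂ (hc.2 r''), fun hc => h p p' h₁ h₂ (hc.2 r'').symm⟩
  rcases hs : S.slot p r'' with _ | ⟨a, b⟩
  · rcases hs' : S.slot p' r'' with _ | ⟨a', b'⟩
    · exact absurd (hs.trans hs'.symm) h
    · refine key (F := .missing r r'') (F' := .sign r' r'' b') hq rfl rfl ⟨rfl, hs⟩
        ⟨rfl, _, hs'⟩ ?_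
      rintro p p' ⟨-, h₁⟩ ⟨-, a, h₂⟩ h
      rw [h₁, h₂] at h
      cases h
  · rcases hs' : S.slot p' r'' with _ | ⟨a', b'⟩
    · refine key (F := .sign r r'' b) (F' := .missing r' r'') hq rfl rfl ⟨rfl, _, hs⟩
        ⟨rfl, hs'⟩ ?_
      rintro p p' ⟨-, a, h₁⟩ ⟨-, h₂⟩ h
      rw [h₁, h₂] at h
      cases h
    by_cases hb : b = b'
    · obtain ⟨i, hi, rfl⟩ := S.exists_var hp hs
      obtain ⟨j, hj, rfl⟩ := S.exists_var hp' hs'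
      have hij : i ≠ j := by
        rintro rfl
        exact h (by rw [hs, hs', hb])
      obtain ⟨q, hq, hq'⟩ := S.separated hi hj hij
      refine key (F := .clBit r r'' (S.bit q (S.name i)))
        (F' := .clBit r' r'' (S.bit q (S.name j))) hq rfl rfl ⟨rfl, _, _, hs, rfl⟩
        ⟨rfl, _, _, hs', rfl⟩ ?_
      rintro p p' ⟨-, a, b, h₁, ha⟩ ⟨-, a', b', h₂, ha'⟩ h
      rw [h₁, h₂] at h
      cases h
      exact hq' (ha.symm.trans ha')
    · refine key (F := .sign r r'' b) (F' := .sign r' r'' b') hq rfl rfl ⟨rfl, _, hs⟩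
        ⟨rfl, _, hs'⟩ ?_
      rintro p p' ⟨-, a, h₁⟩ ⟨-, a', h₂⟩ h
      rw [h₁, h₂] at h
      cases h
      exact hb rfl

/-- Vertices that do not clash belong to a clique that is fixed in advance. -/
theorem covered_of_not_clash {τ τ' : WKind} {p p' : ℕ} (hp : S.IsW τ p) (hp' : S.IsW τ' p')
    (h : ¬ S.Clash τ p τ' p') (h' : ¬ S.Clash τ' p' τ p) : S.Covered τ p τ' p' := by
  have hne := hp.nonempty
  cases τ <;> cases τ' <;> first
    | exact covered_self hne
    | exact absurd trivial h
    | exact absurd trivial h'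
    | exact covered_var_var hp hp' h
    | exact covered_cl_tru hne h
    | exact (covered_cl_tru hne h').symm
    | exact covered_cl_var hp hp' h
    | exact (covered_cl_var hp' hp h').symm
    | exact covered_of_kinds hne fun _ _ _ _ _ => ⟨id, id⟩
    | skip
  -- Only two clause vertices remain.
  rename_i r r'
  by_cases hr : r = r'
  · subst hr
    exact covered_self hne
  · have : ∃ r'', S.slot p r'' ≠ S.slot p' r'' := by
      by_contra hc
      push Not at hc
      exact h ⟨hr, hc⟩
    obtain ⟨r'', hr''⟩ := this
    exact covered_cl_cl hp hp' hr''

/-! ### Four cliques -/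

/-- Colour 0 stands for true, 1 for false, and 2 and 3 for the extra vertices. In every clause the
vertex of one true literal gets 0 and the other two get 2 and 3. -/
theorem exists_coloring (h : S.Sat) : ∃ c : WKind → ℕ → Fin 4, ∀ τ τ' p p', S.IsW τ p →
    S.IsW τ' p' → (τ, p) ≠ (τ', p') → S.Clash τ p τ' p' → c τ p ≠ c τ' p' := by
  obtain ⟨f, hf⟩ := h
  -- The true literal is chosen as a function of the contents of the slots, because vertices of
  -- different occurrences of the same clause may clash. If no slot is true the choice is
  -- irrelevant.
  have : ∀ s : Fin 3 → Option (S.Name × Bool), ∃ r, (∃ r a b, s r = some (a, b) ∧ f a = b) →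
      ∃ a b, s r = some (a, b) ∧ f a = b := by
    intro s
    by_cases hs : ∃ r a b, s r = some (a, b) ∧ f a = b
    · obtain ⟨r, h⟩ := hs
      exact ⟨r, fun _ => h⟩
    · exact ⟨0, fun h => absurd h hs⟩
  choose t ht using this
  let c : WKind → ℕ → Fin 4
    | .fls, _ => 1
    | .tru, _ => 0
    | .extra b, _ => if b then 3 else 2
    | .var b, i => if f (S.name i) = b then 0 else 1
    | .cl r, p => if r = t (S.slot p) then 0 else if r = t (S.slot p) + 1 then 2 else 3
  refine ⟨c, fun τ τ' p p' hp hp' hne hc => ?_⟩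
  cases τ <;> cases τ' <;> try exact hc.elim
  · simp [c]
  · rename_i b; cases b <;> simp [c]
  · simp only [c]; split_ifs <;> decide
  · rename_i b; cases b <;> simp [c]
  · rename_i b b'
    have : b ≠ b' := by
      rintro rfl
      exact hne (by rw [hp.1, hp'.1])
    cases b <;> cases b' <;> simp_all [c]
  · simp only [c]; split_ifs <;> decide
  · rename_i b b'
    obtain rfl : p = p' := hc
    have : b ≠ b' := by
      rintro rfl
      exact hne rfl
    cases b <;> cases b' <;> first
      | exact absurd rfl this
      | simp only [c]; cases f (S.name p) <;> simp
  · rename_i r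
    have hr : r ≠ t (S.slot p) := by
      rintro rfl
      obtain ⟨a, b, h, -⟩ := ht _ (hf p hp)
      exact absurd (h.symm.trans hc) (by simp)
    simp only [c, hr, if_false]
    split_ifs <;> decide
  · rename_i r b
    by_cases hr : r = t (S.slot p)
    · subst hr
      obtain ⟨a, b', h, h'⟩ := ht _ (hf p hp)
      cases h.symm.trans hc
      have : f (S.name p') ≠ b := by rw [h']; simp
      simp [c, this]
    · simp only [c, hr, if_false]
      split_ifs <;> decide
  · rename_i r r'
    obtain ⟨hr, hs⟩ := hc
    have : S.slot p = S.slot p' := funext hs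
    simp only [c, this]
    generalize t (S.slot p') = u
    clear hp hp' hne
    revert r r' u
    decide

/-- The four reference vertices lie in four different cliques, which therefore are all cliques. The
clique `Kt` of `tru` defines the assignment. The cliques may overlap, so membership in `Kt` is not
assumed to exclude membership elsewhere. -/
theorem sat_of_cover {𝒦 : Finset (Set (WKind × ℕ))} (h4 : 𝒦.card ≤ 4)
    (hclash : ∀ K ∈ 𝒦, ∀ τ τ' p p', (τ, p) ∈ K → (τ', p') ∈ K → (τ, p) ≠ (τ', p') →
      ¬ S.Clash τ p τ' p')
    (hcov : ∀ τ p, S.IsW τ p → ∃ K ∈ 𝒦, (τ, p) ∈ K) : S.Sat := by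
  classical
  by_cases hne : S.Nonempty
  swap
  · exact ⟨fun _ => true, fun p hp => absurd (S.nonempty_of_isClause hp) hne⟩
  obtain ⟨Kf, hKf, hf⟩ := hcov .fls 0 ⟨rfl, hne⟩
  obtain ⟨Kt, hKt, ht⟩ := hcov .tru 0 ⟨rfl, hne⟩
  obtain ⟨K₀, hK₀, h₀⟩ := hcov (.extra false) 0 ⟨rfl, hne⟩
  obtain ⟨K₁, hK₁, h₁⟩ := hcov (.extra true) 0 ⟨rfl, hne⟩
  have hft : Kf ≠ Kt := by
    rintro rfl; exact hclash Kf hKf _ _ _ _ hf ht (by simp) trivial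
  have hf0 : Kf ≠ K₀ := by
    rintro rfl; exact hclash Kf hKf _ _ _ _ hf h₀ (by simp) trivial
  have hf1 : Kf ≠ K₁ := by
    rintro rfl; exact hclash Kf hKf _ _ _ _ hf h₁ (by simp) trivial
  have ht0 : Kt ≠ K₀ := by
    rintro rfl; exact hclash Kt hKt _ _ _ _ ht h₀ (by simp) trivial
  have ht1 : Kt ≠ K₁ := by
    rintro rfl; exact hclash Kt hKt _ _ _ _ ht h₁ (by simp) trivial
  have h01 : K₀ ≠ K₁ := by
    rintro rfl; exact hclash K₀ hK₀ _ _ _ _ h₀ h₁ (by simp) trivial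
  have hall : ({Kf, Kt, K₀, K₁} : Finset _) = 𝒦 := by
    apply Finset.eq_of_subset_of_card_le
    · intro K hK
      simp only [Finset.mem_insert, Finset.mem_singleton] at hK
      rcases hK with rfl | rfl | rfl | rfl <;> assumption
    · rw [Finset.card_insert_of_notMem (by simp [hft, hf0, hf1]),
        Finset.card_insert_of_notMem (by simp [ht0, ht1]), Finset.card_pair h01]
      exact h4
  have hcases : ∀ K ∈ 𝒦, K = Kf ∨ K = Kt ∨ K = K₀ ∨ K = K₁ := by
    intro K hK
    simpa [← hall] using hK
  have hvar : ∀ b i, S.IsVar i → (WKind.var b, i) ∈ Kf ∨ (WKind.var b, i) ∈ Kt := by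
    intro b i hi
    obtain ⟨K, hK, hi⟩ := hcov (.var b) i hi
    rcases hcases K hK with rfl | rfl | rfl | rfl
    · exact Or.inl hi
    · exact Or.inr hi
    · exact (hclash _ hK _ _ _ _ hi h₀ (by simp) trivial).elim
    · exact (hclash _ hK _ _ _ _ hi h₁ (by simp) trivial).elim
  have hcl : ∀ r p, S.IsClause p → (WKind.cl r, p) ∈ Kt ∨ (WKind.cl r, p) ∈ K₀ ∨
      (WKind.cl r, p) ∈ K₁ := by
    intro r p hp
    obtain ⟨K, hK, hi⟩ := hcov (.cl r) p hp
    rcases hcases K hK with rfl | rfl | rfl | rfl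
    · exact (hclash _ hK _ _ _ _ hf hi (by simp) trivial).elim
    · exact Or.inl hi
    · exact Or.inr (Or.inl hi)
    · exact Or.inr (Or.inr hi)
  have hone : ∀ K ∈ 𝒦, ∀ r r' p, (WKind.cl r, p) ∈ K → (WKind.cl r', p) ∈ K → r = r' := by
    intro K hK r r' p h h'
    by_contra hr
    exact hclash K hK _ _ _ _ h h' (by simpa using hr) ⟨hr, fun _ => rfl⟩
  refine ⟨fun a => decide (∃ i, S.IsVar i ∧ S.name i = a ∧ (WKind.var true, i) ∈ Kt),
    fun p hp => ?_⟩
  -- Otherwise the three vertices of the clause, which clash pairwise, would lie in `K₀` and `K₁`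
  -- only.
  obtain ⟨r, hr⟩ : ∃ r, (WKind.cl r, p) ∈ Kt := by
    by_contra hc
    push Not at hc
    have h : ∀ r, (WKind.cl r, p) ∈ K₀ ∨ (WKind.cl r, p) ∈ K₁ := fun r =>
      (hcl r p hp).resolve_left (hc r)
    have e₀ := hone K₀ hK₀
    have e₁ := hone K₁ hK₁
    have n01 : (0 : Fin 3) ≠ 1 := by decide
    have n02 : (0 : Fin 3) ≠ 2 := by decide
    have n12 : (1 : Fin 3) ≠ 2 := by decide
    rcases h 0 with a | a <;> rcases h 1 with b | b <;> rcases h 2 with c | c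
    · exact n01 (e₀ _ _ _ a b)
    · exact n01 (e₀ _ _ _ a b)
    · exact n02 (e₀ _ _ _ a c)
    · exact n12 (e₁ _ _ _ b c)
    · exact n12 (e₀ _ _ _ b c)
    · exact n02 (e₁ _ _ _ a c)
    · exact n01 (e₁ _ _ _ a b)
    · exact n01 (e₁ _ _ _ a b)
  rcases hs : S.slot p r with _ | ⟨a, b⟩
  · exact (hclash Kt hKt _ _ _ _ hr ht (by simp) hs).elim
  obtain ⟨i, hi, rfl⟩ := S.exists_var hp hs
  refine ⟨r, _, b, hs, ?_⟩
  -- The clause vertex keeps the negated literal out of `Kt`, hence in `Kf`; this in turn keeps the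
  -- literal itself out of `Kf`, hence in `Kt`.
  have hneg : (WKind.var (!b), i) ∉ Kt := fun h =>
    hclash Kt hKt _ _ _ _ hr h (by simp) (by simpa [Clash] using hs)
  have hpos : (WKind.var b, i) ∈ Kt := by
    have h1 := (hvar (!b) i hi).resolve_right hneg
    refine (hvar b i hi).resolve_left fun h => ?_
    exact hclash Kf hKf _ _ _ _ h h1 (by simp) rfl
  have huniq : (∃ j, S.IsVar j ∧ S.name j = S.name i ∧ (WKind.var true, j) ∈ Kt) ↔
      (WKind.var true, i) ∈ Kt := by
    constructor
    · rintro ⟨j, hj, hij, h⟩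
      rwa [← S.name_inj hj hi hij]
    · exact fun h => ⟨i, hi, rfl, h⟩
  simp only [huniq]
  cases b
  · simpa using hneg
  · simpa using hpos

end ClauseSystem

/-- All pairs of features. -/
@[irreducible] noncomputable def featPairs : Finset (Feat × Feat) :=
  (Set.finite_univ (α := Feat × Feat)).toFinset

theorem mem_featPairs (i : Feat × Feat) : i ∈ featPairs := by
  unfold featPairs
  exact (Set.Finite.mem_toFinset _).2 (Set.mem_univ i)

/-! ### The graph with hub and guards, and its clique covers. -/

namespace ClauseSystem

variable (S : ClauseSystem)

/-- The positions of the vertices of each kind. -/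
def IsVert : VKind → ℕ → Prop
  | .hub, p => p = 0 ∧ S.Nonempty
  | .w τ, p => S.IsW τ p
  | .guard _ _, q => q ∈ S.guards

/-- The edges of the graph, in one of both directions. -/
def Joined : VKind → ℕ → VKind → ℕ → Prop
  | .hub, p, .w τ, p' => p = 0 ∧ S.IsW τ p'
  | .w τ, p, .w τ', p' =>
    S.IsW τ p ∧ S.IsW τ' p' ∧ ¬ S.Clash τ p τ' p' ∧ ¬ S.Clash τ' p' τ p
  | .guard i _, q, .guard i' _, q' => q ∈ S.guards ∧ i = i' ∧ q = q'
  | .guard i _, q, .w τ, p => q ∈ S.guards ∧ S.IsW τ p ∧ S.InPair i q τ p ∧ S.Good i q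
  | _, _, _, _ => False

/-- The graph of the formula. -/
def graph : SimpleGraph (VKind × ℕ) :=
  SimpleGraph.fromRel fun u v => S.Joined u.1 u.2 v.1 v.2

/-- The number of cliques that is allowed for the graph of the formula. -/
noncomputable def budget : ℕ := 4 + featPairs.card * S.guards.card

variable {S}

theorem Joined.isVert {τ τ' : VKind} {p p' : ℕ} (h : S.Joined τ p τ' p') :
    S.IsVert τ p ∧ S.IsVert τ' p' := by
  cases τ <;> cases τ' <;> try exact h.elim
  · exact ⟨⟨h.1, h.2.nonempty⟩, h.2⟩
  · exact ⟨h.1, h.2.1⟩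
  · exact ⟨h.1, h.2.1⟩
  · exact ⟨h.1, h.2.2 ▸ h.1⟩

theorem isVert_of_adj {u v : VKind × ℕ} (h : S.graph.Adj u v) :
    S.IsVert u.1 u.2 ∧ S.IsVert v.1 v.2 := by
  rcases h.2 with h | h
  · exact h.isVert
  · exact h.isVert.symm

theorem joined_w_w {τ τ' : WKind} {p p' : ℕ} (h : S.graph.Adj (.w τ, p) (.w τ', p')) :
    S.IsW τ p ∧ S.IsW τ' p' ∧ ¬ S.Clash τ p τ' p' ∧ ¬ S.Clash τ' p' τ p := by
  rcases h.2 with h | h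
  · exact h
  · exact ⟨h.2.1, h.1, h.2.2.2, h.2.2.1⟩

theorem isClique_hub {c : WKind → ℕ → Fin 4} (hc : ∀ τ τ' p p', S.IsW τ p →
    S.IsW τ' p' → (τ, p) ≠ (τ', p') → S.Clash τ p τ' p' → c τ p ≠ c τ' p') (k : Fin 4) :
    S.graph.IsClique {v | v = (.hub, 0) ∨ ∃ τ p, v = (.w τ, p) ∧ S.IsW τ p ∧ c τ p = k} := by
  rintro u hu v hv huv
  refine ⟨huv, ?_⟩
  rcases hu with rfl | ⟨τ, p, rfl, hp, hk⟩ <;> rcases hv with rfl | ⟨τ', p', rfl, hp', hk'⟩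
  · exact absurd rfl huv
  · exact Or.inl ⟨rfl, hp'⟩
  · exact Or.inr ⟨rfl, hp⟩
  · have hne : (τ, p) ≠ (τ', p') := fun h => huv (by cases h; rfl)
    refine Or.inl ⟨hp, hp', fun h => ?_, fun h => ?_⟩
    · exact hc _ _ _ _ hp hp' hne h (hk.trans hk'.symm)
    · exact hc _ _ _ _ hp' hp hne.symm h (hk'.trans hk.symm)

theorem isClique_guard (i : Feat × Feat) {q : ℕ} (hq : q ∈ S.guards) :
    S.graph.IsClique {v | (∃ b, v = (.guard i b, q)) ∨
      ∃ τ p, v = (.w τ, p) ∧ S.IsW τ p ∧ S.InPair i q τ p ∧ S.Good i q} := by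
  rintro u hu v hv huv
  refine ⟨huv, ?_⟩
  rcases hu with ⟨b, rfl⟩ | ⟨τ, p, rfl, hp, hi, hg⟩ <;>
    rcases hv with ⟨b', rfl⟩ | ⟨τ', p', rfl, hp', hi', hg'⟩
  · exact Or.inl ⟨hq, rfl, rfl⟩
  · exact Or.inl ⟨hq, hp', hi', hg'⟩
  · exact Or.inr ⟨hq, hp, hi, hg⟩
  · have hne : (τ, p) ≠ (τ', p') := fun h => huv (by cases h; rfl)
    exact Or.inl ⟨hp, hp', hg _ _ _ _ hp hp' hi hi' hne, hg _ _ _ _ hp' hp hi' hi hne.symm⟩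

/-- The colour classes together with the hub cover the edges at the hub; the cliques around the
guards cover all others, those inside W by `covered_of_not_clash`. -/
theorem hasEdgeCliqueCover_of_sat (h : S.Sat) : HasEdgeCliqueCover S.graph S.budget := by
  classical
  obtain ⟨c, hc⟩ := exists_coloring h
  let 𝒜 : Finset (Set (VKind × ℕ)) := Finset.univ.image fun k : Fin 4 =>
    {v | v = (.hub, 0) ∨ ∃ τ p, v = (.w τ, p) ∧ S.IsW τ p ∧ c τ p = k}
  let ℬ : Finset (Set (VKind × ℕ)) := (featPairs ×ˢ S.guards).image
    fun x => {v | (∃ b, v = (.guard x.1 b, x.2)) ∨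
      ∃ τ p, v = (.w τ, p) ∧ S.IsW τ p ∧ S.InPair x.1 x.2 τ p ∧ S.Good x.1 x.2}
  have hub : ∀ τ p, S.IsW τ p → ∃ K ∈ 𝒜 ∪ ℬ, (VKind.hub, 0) ∈ K ∧ (VKind.w τ, p) ∈ K := by
    intro τ p hp
    exact ⟨_, Finset.mem_union_left _ (Finset.mem_image_of_mem _ (Finset.mem_univ (c τ p))),
      Or.inl rfl, Or.inr ⟨τ, p, rfl, hp, rfl⟩⟩
  have hB : ∀ i q, q ∈ S.guards → {v | (∃ b, v = (.guard i b, q)) ∨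
      ∃ τ p, v = (.w τ, p) ∧ S.IsW τ p ∧ S.InPair i q τ p ∧ S.Good i q} ∈ 𝒜 ∪ ℬ := by
    intro i q hq
    exact Finset.mem_union_right _ (Finset.mem_image.2 ⟨(i, q),
      Finset.mem_product.2 ⟨mem_featPairs i, hq⟩, rfl⟩)
  have key : ∀ u v : VKind × ℕ, S.Joined u.1 u.2 v.1 v.2 → ∃ K ∈ 𝒜 ∪ ℬ, u ∈ K ∧ v ∈ K := by
    rintro ⟨τ, p⟩ ⟨τ', p'⟩ h
    cases τ <;> cases τ' <;> try exact h.elim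
    · obtain ⟨rfl, h⟩ := h
      exact hub _ _ h
    · obtain ⟨hp, hp', h, h'⟩ := h
      obtain ⟨i, q, hq, hg, hi, hi'⟩ := covered_of_not_clash hp hp' h h'
      exact ⟨_, hB i q hq, Or.inr ⟨_, _, rfl, hp, hi, hg⟩, Or.inr ⟨_, _, rfl, hp', hi', hg⟩⟩
    · obtain ⟨hq, hp, hi, hg⟩ := h
      exact ⟨_, hB _ _ hq, Or.inl ⟨_, rfl⟩, Or.inr ⟨_, _, rfl, hp, hi, hg⟩⟩
    · obtain ⟨hq, rfl, hp⟩ := h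
      obtain rfl : p = p' := hp
      exact ⟨_, hB _ _ hq, Or.inl ⟨_, rfl⟩, Or.inl ⟨_, rfl⟩⟩
  refine ⟨𝒜 ∪ ℬ, ?_, ?_, ?_⟩
  · refine (Finset.card_union_le _ _).trans (add_le_add ?_ ?_)
    · exact Finset.card_image_le.trans (by simp)
    · exact Finset.card_image_le.trans (by rw [Finset.card_product])
  · intro K hK
    rcases Finset.mem_union.1 hK with hK | hK
    · obtain ⟨k, -, rfl⟩ := Finset.mem_image.1 hK
      exact isClique_hub hc k
    · obtain ⟨⟨i, q⟩, hq, rfl⟩ := Finset.mem_image.1 hK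
      exact isClique_guard i (Finset.mem_product.1 hq).2
  · intro u v huv
    rcases huv.2 with h | h
    · exact key u v h
    · obtain ⟨K, hK, hv, hu⟩ := key v u h
      exact ⟨K, hK, hu, hv⟩

/-- Choose for each index a clique through its twin edge. These cliques are distinct and miss the
hub, so at most four cliques contain the hub, and their traces on W satisfy `sat_of_cover`. -/
theorem sat_of_hasEdgeCliqueCover (h : HasEdgeCliqueCover S.graph S.budget) : S.Sat := by
  classical
  obtain ⟨𝒞, hcard, hclique, hcov⟩ := h
  have hg : ∀ x ∈ featPairs ×ˢ S.guards, ∃ K ∈ 𝒞,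
      ((VKind.guard x.1 false, x.2) : VKind × ℕ) ∈ K ∧
      ((VKind.guard x.1 true, x.2) : VKind × ℕ) ∈ K := by
    rintro ⟨i, q⟩ hq
    have hq : q ∈ S.guards := (Finset.mem_product.1 hq).2
    exact hcov _ _ ⟨by simp, Or.inl ⟨hq, rfl, rfl⟩⟩
  choose! κ hκ hκ₀ hκ₁ using hg
  -- Guards in a common clique are adjacent and thus have the same index.
  have hinj : Set.InjOn κ (featPairs ×ˢ S.guards : Finset _) := by
    rintro ⟨i, q⟩ hx ⟨i', q'⟩ hy hxy
    have h₀ := hκ₀ _ hx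
    have h₁ := hκ₁ _ hy
    rw [← hxy] at h₁
    rcases (hclique _ (hκ _ hx) h₀ h₁ (by simp)).2 with ⟨-, h, h'⟩ | ⟨-, h, h'⟩
    · exact Prod.ext h h'
    · exact Prod.ext h.symm h'.symm
  let 𝒜 := 𝒞 \ (featPairs ×ˢ S.guards).image κ
  have h𝒜 : 𝒜.card ≤ 4 := by
    have h₁ : (featPairs ×ˢ S.guards).image κ ⊆ 𝒞 := by
      intro K hK
      obtain ⟨x, hx, rfl⟩ := Finset.mem_image.1 hK
      exact hκ x hx
    rw [Finset.card_sdiff_of_subset h₁, Finset.card_image_of_injOn hinj, Finset.card_product]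
    unfold budget at hcard
    omega
  refine sat_of_cover (𝒦 := 𝒜.image fun K => {x | (VKind.w x.1, x.2) ∈ K})
    (Finset.card_image_le.trans h𝒜) ?_ ?_
  · intro K hK τ τ' p p' h h' hne
    obtain ⟨K, hK', rfl⟩ := Finset.mem_image.1 hK
    have hadj := hclique K (Finset.mem_sdiff.1 hK').1 h h' fun h => hne (by cases h; rfl)
    exact (joined_w_w hadj).2.2.1
  · intro τ p hp
    obtain ⟨K, hK, h₀, h₁⟩ := hcov (.hub, 0) (.w τ, p) ⟨by simp, Or.inl ⟨rfl, hp⟩⟩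
    -- A clique containing the hub is not one of the chosen ones, as guards are not adjacent to the
    -- hub.
    refine ⟨_, Finset.mem_image_of_mem _ (Finset.mem_sdiff.2 ⟨hK, fun hK' => ?_⟩), h₁⟩
    obtain ⟨x, hx, rfl⟩ := Finset.mem_image.1 hK'
    rcases (hclique _ hK h₀ (hκ₀ x hx) (by simp)).2 with h | h <;> exact h

theorem hasEdgeCliqueCover_iff : HasEdgeCliqueCover S.graph S.budget ↔ S.Sat :=
  ⟨sat_of_hasEdgeCliqueCover, hasEdgeCliqueCover_of_sat⟩

end ClauseSystem

/-- Edge clique covers of a graph and of an induced subgraph that contains all edges. -/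
theorem hasEdgeCliqueCover_comap_iff {V W : Type*} (G : SimpleGraph V) (f : W → V)
    (hf : f.Injective) (h : ∀ u v, G.Adj u v → u ∈ Set.range f) (k : ℕ) :
    HasEdgeCliqueCover (G.comap f) k ↔ HasEdgeCliqueCover G k := by
  classical
  constructor
  · rintro ⟨𝒞, hk, hc, he⟩
    refine ⟨𝒞.image (Set.image f), Finset.card_image_le.trans hk, ?_, ?_⟩
    · intro K hK
      obtain ⟨K, hK', rfl⟩ := Finset.mem_image.1 hK
      rintro _ ⟨u, hu, rfl⟩ _ ⟨v, hv, rfl⟩ huv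
      exact hc K hK' hu hv fun h => huv (by rw [h])
    · intro u v huv
      obtain ⟨u, rfl⟩ := h u v huv
      obtain ⟨v, rfl⟩ := h v _ huv.symm
      obtain ⟨K, hK, hu, hv⟩ := he u v huv
      exact ⟨_, Finset.mem_image_of_mem _ hK, ⟨u, hu, rfl⟩, ⟨v, hv, rfl⟩⟩
  · rintro ⟨𝒞, hk, hc, he⟩
    refine ⟨𝒞.image (Set.preimage f), Finset.card_image_le.trans hk, ?_, ?_⟩
    · intro K hK
      obtain ⟨K, hK', rfl⟩ := Finset.mem_image.1 hK
      intro u hu v hv huv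
      exact hc K hK' hu hv fun h => huv (hf h)
    · intro u v huv
      obtain ⟨K, hK, hu, hv⟩ := he _ _ huv
      exact ⟨_, Finset.mem_image_of_mem _ hK, hu, hv⟩

/-! ### Formulas as words -/

namespace CNFWord

open Classical

/-- The symbol is a binary digit. -/
def isBit : CNFSymbol → Bool
  | .bit _ => true
  | _ => false

/-- There is a literal at position `l`. -/
def IsLit (x : List CNFSymbol) (l : ℕ) : Prop := ∃ b, x[l]? = some (.lit b)

/-- The digits of the variable of the literal at position `l`. -/
def litName (x : List CNFSymbol) (l : ℕ) : List CNFSymbol := (x.drop (l + 1)).takeWhile isBit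

/-- The literal at position `l` is the first occurrence of its variable. -/
def FirstOcc (x : List CNFSymbol) (l : ℕ) : Prop :=
  IsLit x l ∧ ∀ l' < x.length, l' < l → IsLit x l' → litName x l' ≠ litName x l

/-- The literal at position `l` has number `r` in the clause at position `p`. -/
def LitAt (x : List CNFSymbol) (p r l : ℕ) : Prop :=
  p < l ∧ IsLit x l ∧ (∀ u < x.length, p < u → u < l → x[u]? ≠ some .clause) ∧
    countBelow x.length (fun u => p < u ∧ u < l ∧ IsLit x u) = r

/-- The variable and the sign of the literal with number `r` in the clause at position `p`. -/
noncomputable def slot (x : List CNFSymbol) (p r : ℕ) : Option (List CNFSymbol × Bool) :=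
  if h : ∃ l, LitAt x p r l then
    some (litName x h.choose, decide (x[h.choose]? = some (.lit true)))
  else none

/-- The number of variables that occur before position `l`. -/
noncomputable def index (x : List CNFSymbol) (l : ℕ) : ℕ :=
  countBelow x.length fun u => FirstOcc x u ∧ u < l

/-- The number of variables. -/
noncomputable def varCount (x : List CNFSymbol) : ℕ :=
  countBelow x.length (FirstOcc x)

/-- The digit with weight `q` in the number of a variable. -/
noncomputable def digit (x : List CNFSymbol) (q : ℕ) (a : List CNFSymbol) : Bool :=
  decide (∃ l < x.length, FirstOcc x l ∧ litName x l = a ∧ index x l / q % 2 = 1)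

/-- The weights of the digits of the numbers of the variables, and `0`. -/
noncomputable def guards (x : List CNFSymbol) : Finset ℕ :=
  (Finset.range x.length).filter fun q => q = 0 ∨ (∃ k, q = 2 ^ k) ∧ q < varCount x

variable {x : List CNFSymbol}

theorem IsLit.lt_length {l : ℕ} (h : IsLit x l) : l < x.length := by
  obtain ⟨b, h⟩ := h
  exact (List.getElem?_eq_some_iff.1 h).1

/-- Of two candidates, the earlier one is counted before the later one but not before itself, so
their numbers differ. -/
theorem LitAt.unique {p r l l' : ℕ} (h : LitAt x p r l) (h' : LitAt x p r l') : l = l' := by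
  have key : ∀ {l l'}, LitAt x p r l → LitAt x p r l' → ¬ l < l' := by
    intro l l' h h' hl
    have : countBelow x.length (fun u => p < u ∧ u < l ∧ IsLit x u) <
        countBelow x.length (fun u => p < u ∧ u < l' ∧ IsLit x u) := by
      apply Finset.card_lt_card
      rw [Finset.ssubset_iff_of_subset]
      · refine ⟨l, ?_, ?_⟩
        · simpa using ⟨h.2.1.lt_length, h.1, hl, h.2.1⟩
        · simp
      · intro u
        simp only [Finset.mem_filter]
        rintro ⟨h₁, h₂, h₃, h₄⟩
        exact ⟨h₁, h₂, h₃.trans hl, h₄⟩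
    rw [h.2.2.2, h'.2.2.2] at this
    exact lt_irrefl _ this
  exact le_antisymm (not_lt.1 (key h' h)) (not_lt.1 (key h h'))

theorem slot_eq_some_iff {p r : ℕ} {a : List CNFSymbol} {b : Bool} :
    slot x p r = some (a, b) ↔
      ∃ l < x.length, LitAt x p r l ∧ litName x l = a ∧ x[l]? = some (.lit b) := by
  unfold slot
  constructor
  · intro h
    split_ifs at h with hl
    obtain ⟨b', hb'⟩ := hl.choose_spec.2.1
    simp only [Option.some.injEq, Prod.mk.injEq] at h
    refine ⟨_, hl.choose_spec.2.1.lt_length, hl.choose_spec, h.1, ?_⟩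
    rw [hb', ← h.2, hb']
    cases b' <;> simp
  · rintro ⟨l, -, hl, rfl, hb⟩
    have h : ∃ l, LitAt x p r l := ⟨l, hl⟩
    rw [dif_pos h, h.choose_spec.unique hl, hb]
    cases b <;> simp

theorem slot_eq_none_iff {p r : ℕ} : slot x p r = none ↔ ¬ ∃ l < x.length, LitAt x p r l := by
  unfold slot
  split_ifs with h
  · obtain ⟨l, hl⟩ := h
    simpa using ⟨l, hl.2.1.lt_length, hl⟩
  · simpa using fun l _ hl => h ⟨l, hl⟩

theorem index_lt_index {i j : ℕ} (hi : FirstOcc x i) (hij : i < j) : index x i < index x j := by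
  unfold index countBelow
  apply Finset.card_lt_card
  rw [Finset.ssubset_iff_of_subset]
  · exact ⟨i, by simpa using ⟨hi.1.lt_length, hi, hij⟩, by simp⟩
  · intro u
    simp only [Finset.mem_filter]
    rintro ⟨h₁, h₂, h₃⟩
    exact ⟨h₁, h₂, h₃.trans hij⟩

theorem index_lt_varCount {i : ℕ} (hi : FirstOcc x i) : index x i < varCount x := by
  unfold index varCount countBelow
  apply Finset.card_lt_card
  rw [Finset.ssubset_iff_of_subset]
  · exact ⟨i, by simpa using ⟨hi.1.lt_length, hi⟩, by simp⟩
  · intro u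
    simp only [Finset.mem_filter]
    rintro ⟨h₁, h₂, -⟩
    exact ⟨h₁, h₂⟩

theorem varCount_le : varCount x ≤ x.length := by
  unfold varCount countBelow
  exact (Finset.card_filter_le _ _).trans (by simp)

theorem FirstOcc.eq {i j : ℕ} (hi : FirstOcc x i) (hj : FirstOcc x j)
    (h : litName x i = litName x j) : i = j := by
  rcases lt_trichotomy i j with hij | hij | hij
  · exact absurd h (hj.2 i hi.1.lt_length hij hi.1)
  · exact hij
  · exact absurd h.symm (hi.2 j hj.1.lt_length hij hj.1)

theorem digit_litName {i : ℕ} (hi : FirstOcc x i) (q : ℕ) :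
    digit x q (litName x i) = decide (index x i / q % 2 = 1) := by
  unfold digit
  rw [decide_eq_decide]
  constructor
  · rintro ⟨l, -, hl, h, h'⟩
    rwa [← hl.eq hi h]
  · exact fun h => ⟨i, hi.1.lt_length, hi, rfl, h⟩

theorem exists_firstOcc {l : ℕ} (hl : IsLit x l) :
    ∃ i, FirstOcc x i ∧ litName x i = litName x l := by
  have h : ∃ i, IsLit x i ∧ litName x i = litName x l := ⟨l, hl, rfl⟩
  refine ⟨Nat.find h, ⟨(Nat.find_spec h).1, fun l' _ hl' hlit heq => ?_⟩, (Nat.find_spec h).2⟩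
  exact Nat.find_min h hl' ⟨hlit, heq.trans (Nat.find_spec h).2⟩

/-- Different variables have different numbers below `varCount x`. A binary digit in which these
differ is 1 in one of them, so its weight is at most that number and thus is a guard. -/
theorem exists_guard {i j : ℕ} (hi : FirstOcc x i) (hj : FirstOcc x j) (hij : i ≠ j) :
    ∃ q ∈ guards x, digit x q (litName x i) ≠ digit x q (litName x j) := by
  have hne : index x i ≠ index x j := by
    rcases lt_or_gt_of_ne hij with h | h
    · exact (index_lt_index hi h).ne
    · exact (index_lt_index hj h).ne'
  obtain ⟨k, hk⟩ : ∃ k, (index x i).testBit k ≠ (index x j).testBit k := by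
    by_contra h
    push Not at h
    exact hne (Nat.eq_of_testBit_eq h)
  have hlt : 2 ^ k < varCount x := by
    rcases hb : (index x i).testBit k with _ | _
    · have : (index x j).testBit k = true := by
        rw [hb] at hk
        simpa using hk.symm
      exact (Nat.ge_two_pow_of_testBit this).trans_lt (index_lt_varCount hj)
    · exact (Nat.ge_two_pow_of_testBit hb).trans_lt (index_lt_varCount hi)
  refine ⟨2 ^ k, ?_, ?_⟩
  · simp only [guards, Finset.mem_filter, Finset.mem_range]
    exact ⟨hlt.trans_le varCount_le, Or.inr ⟨⟨k, rfl⟩, hlt⟩⟩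
  · rw [digit_litName hi, digit_litName hj]
    simpa only [Nat.testBit_eq_decide_div_mod_eq] using hk

/-- The clauses and variables of a word. -/
noncomputable def system (x : List CNFSymbol) : ClauseSystem where
  Name := List CNFSymbol
  Nonempty := 0 < x.length
  IsVar := FirstOcc x
  IsClause p := x[p]? = some .clause
  name := litName x
  slot p r := slot x p r
  guards := guards x
  bit := digit x
  nonempty_of_isClause h := by
    have := (List.getElem?_eq_some_iff.1 h).1
    omega
  nonempty_of_isVar h := by
    have := h.1.lt_length
    omega
  guards_nonempty h := ⟨0, by simpa [guards] using h⟩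
  name_inj hi hj h := hi.eq hj h
  exists_var _ h := by
    obtain ⟨l, -, hl, rfl, -⟩ := slot_eq_some_iff.1 h
    exact exists_firstOcc hl.2.1
  separated := exists_guard

end CNFWord

/-! ### Definability of arithmetic and of the syntax of formulas. -/

namespace PointerProg.Definable

open CNFWord Classical

variable {d : ℕ}

theorem lt_length (i : Fin d) : Definable fun x e => e i < x.length :=
  (eq 0 i.succ).ex.congr fun x e _ => by simp [Fin.cons_zero, Fin.cons_succ]

theorem eq_zero (i : Fin d) : Definable fun _ e => e i = 0 :=
  (pos i).not.congr fun _ _ _ => by simp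

theorem isLit (i : Fin d) : Definable fun x e => IsLit x (e i) :=
  ((sym i (.lit true)).or (sym i (.lit false))).congr fun x e _ => by simp [IsLit, or_comm]

/-- There is a binary digit at position `l`. -/
theorem isBit (i : Fin d) : Definable fun x e => ∃ b, x[e i]? = some (.bit b) :=
  ((sym i (.bit true)).or (sym i (.bit false))).congr fun x e _ => by simp [or_comm]

theorem lt_count {P : List CNFSymbol → (Fin (d + 1) → ℕ) → Prop} (hP : Definable P) (j : Fin d) :
    Definable fun x e =>
      e j < countBelow x.length (fun a => P x (Fin.cons a e)) := by
  unfold countBelow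
  refine (bind (Countable.indicator hP).sum (lt j.succ 0)).congr fun x e _ => ?_
  rw [Fin.cons_zero, Fin.cons_succ, Finset.sum_boole, Nat.cast_id, min_eq_right]
  exact (Finset.card_filter_le _ _).trans (by simp)

/-- The sum is right exactly if `e i ≤ e k` and the interval from `e i` to `e k` has `e j` elements.
-/
theorem add (i j k : Fin d) : Definable fun _ e => e i + e j = e k := by
  have h : Definable fun _ (e : Fin (d + 1) → ℕ) => e i.succ ≤ e 0 ∧ e 0 < e k.succ :=
    (le _ _).and (lt _ _)
  refine ((le i k).and (h.count j)).congr fun x e he => ?_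
  have : ((Finset.range x.length).filter fun a => e i ≤ a ∧ a < e k) = Finset.Ico (e i) (e k) := by
    ext a
    have := he k
    simp only [Finset.mem_filter, Finset.mem_range, Finset.mem_Ico]
    omega
  simp only [countBelow, Fin.cons_zero, Fin.cons_succ, this, Nat.card_Ico]
  omega

theorem succ (i j : Fin d) : Definable fun _ e => e i + 1 = e j := by
  have h : Definable fun _ (e : Fin (d + 1) → ℕ) => e i.succ < e 0 ∧ e 0 < e j.succ :=
    (lt _ _).and (lt _ _)
  refine ((lt i j).and h.ex.not).congr fun x e he => ?_
  simp only [Fin.cons_zero, Fin.cons_succ]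
  have := he j
  constructor
  · rintro ⟨h₁, h₂⟩
    by_contra h
    exact h₂ ⟨e i + 1, by omega, by omega, by omega⟩
  · intro h
    refine ⟨by omega, ?_⟩
    rintro ⟨a, ha⟩
    omega

/-- A number is the product if it is not below the product but its predecessor, if any, is. For `e k
< x.length` the truncation in `lt_mul` is harmless. -/
theorem mul (i j k : Fin d) : Definable fun x e => e k < x.length ∧ e i * e j = e k := by
  have h : Definable fun x (e : Fin (d + 1) → ℕ) =>
      e 0 + 1 = e k.succ → e 0 < min x.length (e i.succ * e j.succ) :=
    (succ _ _).imp (lt_mul _ _ _)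
  refine ((lt_length k).and ((lt_mul i j k).not.and h.all)).congr fun x e he => ?_
  simp only [Fin.cons_zero, Fin.cons_succ]
  refine and_congr_right fun hk => ?_
  constructor
  · rintro ⟨h₁, h₂⟩
    rw [lt_min_iff] at h₁
    rcases hm : e k with _ | m
    · omega
    · have := h₂ m (by omega) hm.symm
      rw [lt_min_iff] at this
      omega
  · intro h
    refine ⟨by rw [lt_min_iff]; omega, fun m hm hmk => ?_⟩
    rw [lt_min_iff]
    omega

/-- Division with remainder is guessed: `e i = (2 * u + 1) * e j + s` with `s < e j`. All
intermediate values are at most `e i`, hence are positions of the word. -/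
theorem odd_div (i j : Fin d) : Definable fun x e => e i < x.length ∧ e i / e j % 2 = 1 := by
  have h : Definable fun x (e : Fin (d + 5) → ℕ) =>
      (e 0 < x.length ∧ e 1 * e j.succ.succ.succ.succ.succ = e 0) ∧
      e 0 + e 2 = e i.succ.succ.succ.succ.succ ∧ e 2 < e j.succ.succ.succ.succ.succ ∧
      e 3 + e 3 = e 4 ∧ e 4 + 1 = e 1 :=
    (mul _ _ _).and ((add _ _ _).and ((lt _ _).and ((add _ _ _).and (succ _ _))))
  refine ((lt_length i).and h.ex.ex.ex.ex.ex).congr fun x e he => ?_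
  refine and_congr_right fun hi => ?_
  change (∃ t < x.length, ∃ u < x.length, ∃ s < x.length, ∃ m < x.length, ∃ y < x.length,
    (y < x.length ∧ m * e j = y) ∧ y + s = e i ∧ s < e j ∧ u + u = t ∧ t + 1 = m) ↔ _
  generalize e i = r at *
  generalize e j = q
  constructor
  · rintro ⟨t, -, u, -, s, -, m, -, y, -, ⟨-, rfl⟩, rfl, hs, rfl, rfl⟩
    have : ((u + u + 1) * q + s) / q = u + u + 1 := by
      rw [mul_comm, Nat.mul_add_div (by omega), Nat.div_eq_of_lt hs, add_zero]
    rw [this]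
    omega
  · intro h
    have hq : 0 < q := by
      rcases Nat.eq_zero_or_pos q with rfl | hq
      · simp at h
      · exact hq
    have h₁ := Nat.div_add_mod r q
    have h₂ := Nat.mod_lt r hq
    have h₃ : r / q ≤ r := Nat.div_le_self r q
    have h₄ : q * (r / q) ≤ r := Nat.mul_div_le r q
    have h₅ := Nat.mod_le r q
    generalize r / q = m at *
    generalize r % q = s at *
    generalize hy : q * m = y at *
    exact ⟨m - 1, by omega, (m - 1) / 2, by omega, s, by omega, m, by omega,
      y, by omega, ⟨by omega, by rw [← hy, mul_comm]⟩, h₁, h₂, by omega, by omega⟩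

/-- The powers of two are the positive numbers whose divisors are 1 or even. The bound `B` turns
this into a statement with bounded quantifiers. -/
theorem _root_.Nat.eq_two_pow_iff {q B : ℕ} (hq : q < B) : (∃ k, q = 2 ^ k) ↔
    0 < q ∧ ∀ a < B, ∀ b < B, (q < B ∧ a * b = q) → a ≤ 1 ∨ ∃ c < B, c + c = a := by
  constructor
  · rintro ⟨k, rfl⟩
    refine ⟨by positivity, fun a ha b hb hab => ?_⟩
    obtain ⟨m, -, rfl⟩ := (Nat.dvd_prime_pow Nat.prime_two).1 ⟨b, hab.2.symm⟩
    rcases m with _ | m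
    · simp
    · refine Or.inr ⟨2 ^ m, ?_, by rw [pow_succ]; omega⟩
      refine lt_of_le_of_lt ?_ ha
      exact Nat.pow_le_pow_right (by norm_num) (Nat.le_succ m)
  · rintro ⟨h0, h⟩
    rcases Nat.eq_two_pow_or_exists_odd_prime_and_dvd q with h' | ⟨p, hp, ⟨b, rfl⟩, hodd⟩
    · exact h'
    · have hb : 0 < b := by
        rcases Nat.eq_zero_or_pos b with rfl | hb
        · simp at h0
        · exact hb
      have h₁ : p ≤ p * b := Nat.le_mul_of_pos_right p hb
      have h₂ : b ≤ p * b := Nat.le_mul_of_pos_left b hp.pos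
      rcases h p (by omega) b (by omega) ⟨hq, rfl⟩ with h | ⟨c, -, h⟩
      · exact absurd hp.one_lt (by omega)
      · obtain ⟨t, ht⟩ := hodd
        omega

theorem eq_const (r : ℕ) (i : Fin d) : Definable fun _ e => e i = r := by
  induction r generalizing d with
  | zero => exact eq_zero i
  | succ r ih =>
    have h : Definable fun _ (e : Fin (d + 1) → ℕ) => e 0 = r ∧ e 0 + 1 = e i.succ :=
      (ih 0).and (succ _ _)
    refine h.ex.congr fun x e he => ?_
    simp only [Fin.cons_zero, Fin.cons_succ]
    have := he i
    constructor
    · rintro ⟨a, ha, rfl, h'⟩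
      exact h'.symm
    · intro h
      exact ⟨r, by omega, rfl, h.symm⟩

theorem le_one (i : Fin d) : Definable fun _ e => e i ≤ 1 :=
  ((eq_const 0 i).or (eq_const 1 i)).congr fun _ _ _ => by omega

theorem two_pow (i : Fin d) : Definable fun x e => e i < x.length ∧ ∃ k, e i = 2 ^ k := by
  have h₁ : Definable fun _ (e : Fin (d + 3) → ℕ) => e 0 + e 0 = e (2 : Fin (d + 3)) := add _ _ _
  have h₂ : Definable fun x (e : Fin (d + 2) → ℕ) =>
      (e i.succ.succ < x.length ∧ e 1 * e 0 = e i.succ.succ) →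
        e 1 ≤ 1 ∨ ∃ c < x.length, c + c = e 1 :=
    (mul _ _ _).imp ((le_one _).or (h₁.ex.congr fun _ _ _ => Iff.rfl))
  refine ((lt_length i).and ((pos i).and h₂.all.all)).congr fun x e he => ?_
  refine and_congr_right fun hi => ?_
  rw [Nat.eq_two_pow_iff hi]
  exact Iff.rfl

/-- Each half says that one initial run is a prefix of the other list; both together force equal
runs. This replaces equality of words by conditions on single positions. -/
theorem _root_.List.takeWhile_eq_takeWhile_iff {α : Type*} (p : α → Bool) (l l' : List α) :
    l.takeWhile p = l'.takeWhile p ↔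
      (∀ t : ℕ, (∀ s ≤ t, ∃ c, l[s]? = some c ∧ p c) → l[t]? = l'[t]?) ∧
      (∀ t : ℕ, (∀ s ≤ t, ∃ c, l'[s]? = some c ∧ p c) → l'[t]? = l[t]?) := by
  induction l generalizing l' with
  | nil =>
    rcases l' with _ | ⟨a, l'⟩
    · simp
    · by_cases ha : p a
      · simp only [List.takeWhile_nil, List.takeWhile_cons, ha, if_true]
        refine iff_of_false (by simp) fun h => ?_
        simpa using h.2 0 (by simpa using ha)
      · simp only [List.takeWhile_nil, List.takeWhile_cons, ha]
        refine iff_of_true rfl ⟨fun t h => ?_, fun t h => ?_⟩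
        · simpa using h 0 (by simp)
        · exact absurd (by simpa using h 0 (by simp)) ha
  | cons a l ih =>
    by_cases ha : p a
    · rcases l' with _ | ⟨b, l'⟩
      · simp only [List.takeWhile_nil, List.takeWhile_cons, ha, if_true]
        refine iff_of_false (by simp) fun h => ?_
        simpa using h.1 0 (by simpa using ha)
      · by_cases hb : p b
        · simp only [List.takeWhile_cons, ha, hb, if_true, List.cons.injEq, ih]
          have shift : ∀ (a b : α) (l l' : List α), p a → a = b →
              ((∀ t : ℕ, (∀ s ≤ t, ∃ c, (a :: l)[s]? = some c ∧ p c) →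
                  (a :: l)[t]? = (b :: l')[t]?) ↔
                ∀ t : ℕ, (∀ s ≤ t, ∃ c, l[s]? = some c ∧ p c) → l[t]? = l'[t]?) := by
            rintro a _ l l' ha rfl
            constructor
            · intro h t ht
              have := h (t + 1) (fun s hs => by
                rcases s with _ | s
                · exact ⟨a, rfl, ha⟩
                · simpa using ht s (by omega))
              simpa using this
            · intro h t ht
              rcases t with _ | t
              · rfl
              · simpa using h t fun s hs => by simpa using ht (s + 1) (by omega)
          constructor
          · rintro ⟨hab, h₁, h₂⟩
            exact ⟨(shift a b l l' ha hab).2 h₁, (shift b a l' l hb hab.symm).2 h₂⟩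
          · rintro ⟨h₁, h₂⟩
            have hab : a = b := by simpa using h₁ 0 (by simpa using ha)
            exact ⟨hab, (shift a b l l' ha hab).1 h₁, (shift b a l' l hb hab.symm).1 h₂⟩
        · simp only [List.takeWhile_cons, ha, hb, if_true]
          refine iff_of_false (by simp) fun h => ?_
          have := h.1 0 (by simpa using ha)
          simp only [List.getElem?_cons_zero, Option.some.injEq] at this
          exact hb (this ▸ ha)
    · rcases l' with _ | ⟨b, l'⟩
      · simp only [List.takeWhile_nil, List.takeWhile_cons, ha]
        refine iff_of_true rfl ⟨fun t h => ?_, fun t h => ?_⟩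
        · exact absurd (by simpa using h 0 (by simp)) ha
        · simpa using h 0 (by simp)
      · by_cases hb : p b
        · simp only [List.takeWhile_cons, ha, hb, if_true]
          refine iff_of_false (by simp) fun h => ?_
          have := h.2 0 (by simpa using hb)
          simp only [List.getElem?_cons_zero, Option.some.injEq] at this
          exact ha (this ▸ hb)
        · simp only [List.takeWhile_cons, ha, hb]
          refine iff_of_true rfl ⟨fun t h => ?_, fun t h => ?_⟩
          · exact absurd (by simpa using h 0 (by simp)) ha
          · exact absurd (by simpa using h 0 (by simp)) hb

/-- Offsets are replaced by absolute positions `u` and `v`, so that only quantifiers over positions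
of `x` occur. -/
theorem digits_agree_iff (x : List CNFSymbol) {l l' : ℕ} :
    (∀ t : ℕ, (∀ s ≤ t, ∃ c, (x.drop (l + 1))[s]? = some c ∧ CNFWord.isBit c) →
      (x.drop (l + 1))[t]? = (x.drop (l' + 1))[t]?) ↔
    ∀ u < x.length, (l < u ∧ ∀ w < x.length, l < w ∧ w ≤ u → ∃ b, x[w]? = some (.bit b)) →
      ∃ v < x.length, (∃ t < x.length, l + t = u ∧ l' + t = v) ∧
        ∀ b, x[u]? = some (CNFSymbol.bit b) → x[v]? = some (CNFSymbol.bit b) := by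
  have hbit : ∀ w : ℕ, (∃ c, x[w]? = some c ∧ CNFWord.isBit c) ↔
      ∃ b, x[w]? = some (CNFSymbol.bit b) := by
    intro w
    constructor
    · rintro ⟨c, hc, h⟩
      cases c <;> simp [CNFWord.isBit] at h
      exact ⟨_, hc⟩
    · rintro ⟨b, h⟩
      exact ⟨_, h, rfl⟩
  simp only [List.getElem?_drop, hbit]
  constructor
  · rintro h u hu ⟨hlu, hw⟩
    have h₁ := h (u - (l + 1)) fun s hs =>
      hw (l + 1 + s) (by omega) ⟨by omega, by omega⟩
    rw [show l + 1 + (u - (l + 1)) = u by omega] at h₁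
    obtain ⟨b, hb⟩ := hw u hu ⟨hlu, le_rfl⟩
    rw [hb] at h₁
    -- The common offset `u - l` is measured from the literals themselves, not from their first
    -- digits.
    refine ⟨l' + 1 + (u - (l + 1)), (List.getElem?_eq_some_iff.1 h₁.symm).1,
      ⟨u - l, by omega, by omega, by omega⟩, fun b' hb' => ?_⟩
    rw [← h₁, ← hb, hb']
  · intro h t ht
    obtain ⟨b, hb⟩ := ht t le_rfl
    have hlen := (List.getElem?_eq_some_iff.1 hb).1
    obtain ⟨v, -, ⟨t', -, h₁, h₂⟩, h₃⟩ := h (l + 1 + t) hlen ⟨by omega, fun w _ hw => by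
      obtain ⟨b, hb⟩ := ht (w - (l + 1)) (by omega)
      rw [show l + 1 + (w - (l + 1)) = w by omega] at hb
      exact ⟨b, hb⟩⟩
    rw [hb, show l' + 1 + t = v by omega, h₃ b hb]

theorem litName_eq (i j : Fin d) : Definable fun x e => litName x (e i) = litName x (e j) := by
  have key : ∀ i j : Fin d, Definable fun x e => ∀ u < x.length,
      (e i < u ∧ ∀ w < x.length, e i < w ∧ w ≤ u → ∃ b, x[w]? = some (.bit b)) →
      ∃ v < x.length, (∃ t < x.length, e i + t = u ∧ e j + t = v) ∧
        ∀ b, x[u]? = some (.bit b) → x[v]? = some (.bit b) := by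
    intro i j
    have h₁ : Definable fun x (e : Fin (d + 2) → ℕ) =>
        e i.succ.succ < e 0 ∧ e 0 ≤ e 1 → ∃ b, x[e 0]? = some (.bit b) :=
      ((lt _ _).and (le _ _)).imp (isBit _)
    have h₂ : Definable fun _ (e : Fin (d + 3) → ℕ) =>
        e i.succ.succ.succ + e 0 = e 2 ∧ e j.succ.succ.succ + e 0 = e 1 :=
      (add _ _ _).and (add _ _ _)
    have h₃ : Definable fun x (e : Fin (d + 2) → ℕ) =>
        ∀ b, x[e 1]? = some (.bit b) → x[e 0]? = some (.bit b) :=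
      forall_fintype fun b => (sym _ _).imp (sym _ _)
    have h₄ : Definable fun _ (e : Fin (d + 1) → ℕ) => e i.succ < e 0 := lt _ _
    exact ((h₄.and h₁.all).imp (h₂.ex.and h₃).ex).all.congr fun _ _ _ => Iff.rfl
  refine ((key i j).and (key j i)).congr fun x e he => ?_
  unfold litName
  rw [List.takeWhile_eq_takeWhile_iff, digits_agree_iff x, digits_agree_iff x]

theorem firstOcc (i : Fin d) : Definable fun x e => FirstOcc x (e i) := by
  have h : Definable fun x (e : Fin (d + 1) → ℕ) =>
      e 0 < e i.succ → IsLit x (e 0) → ¬ litName x (e 0) = litName x (e i.succ) :=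
    (lt _ _).imp ((isLit _).imp (litName_eq _ _).not)
  exact ((isLit i).and h.all).congr fun _ _ _ => Iff.rfl

theorem count_eq_const {P : List CNFSymbol → (Fin (d + 1) → ℕ) → Prop} (hP : Definable P)
    (r : ℕ) : Definable fun x e => countBelow x.length (fun a => P x (Fin.cons a e)) = r := by
  unfold countBelow
  refine (bind (Countable.indicator hP).sum (eq_const r 0)).congr fun x e _ => ?_
  rw [Fin.cons_zero, Finset.sum_boole, Nat.cast_id, min_eq_right]
  exact (Finset.card_filter_le _ _).trans (by simp)

theorem litAt (r : ℕ) (i j : Fin d) : Definable fun x e => LitAt x (e i) r (e j) := by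
  have h₁ : Definable fun x (e : Fin (d + 1) → ℕ) =>
      e i.succ < e 0 → e 0 < e j.succ → ¬ x[e 0]? = some .clause :=
    (lt _ _).imp ((lt _ _).imp (sym _ _).not)
  have h₂ : Definable fun x (e : Fin (d + 1) → ℕ) =>
      e i.succ < e 0 ∧ e 0 < e j.succ ∧ IsLit x (e 0) :=
    (lt _ _).and ((lt _ _).and (isLit _))
  exact ((lt i j).and ((isLit j).and (h₁.all.and (h₂.count_eq_const r)))).congr
    fun _ _ _ => Iff.rfl

theorem digit (i j : Fin d) : Definable fun x e => digit x (e i) (litName x (e j)) = true := by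
  have h₁ : Definable fun x (e : Fin (d + 3) → ℕ) => FirstOcc x (e 0) ∧ e 0 < e 2 :=
    (firstOcc _).and (lt _ _)
  have h₂ : Definable fun x (e : Fin (d + 2) → ℕ) =>
      (e 0 < x.length ∧ e 0 / e i.succ.succ % 2 = 1) := odd_div _ _
  have h₃ : Definable fun x (e : Fin (d + 1) → ℕ) =>
      FirstOcc x (e 0) ∧ litName x (e 0) = litName x (e j.succ) :=
    (firstOcc _).and (litName_eq _ _)
  have h₄ : Definable fun x (e : Fin (d + 2) → ℕ) => index x (e 1) = e 0 :=
    (h₁.count 0).congr fun _ _ _ => Iff.rfl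
  refine ((h₃.and (h₄.and h₂).ex).ex).congr fun x e he => ?_
  simp only [CNFWord.digit, decide_eq_true_eq]
  change (∃ l < x.length, (FirstOcc x l ∧ litName x l = litName x (e j)) ∧
    ∃ r < x.length, index x l = r ∧ r < x.length ∧ r / e i % 2 = 1) ↔ _
  constructor
  · rintro ⟨l, hl, ⟨h₁, h₂⟩, r, hr, rfl, -, h₃⟩
    exact ⟨l, hl, h₁, h₂, h₃⟩
  · rintro ⟨l, hl, h₁, h₂, h₃⟩
    have := (index_lt_varCount h₁).trans_le varCount_le
    exact ⟨l, hl, ⟨h₁, h₂⟩, _, this, rfl, this, h₃⟩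

theorem mem_guards (i : Fin d) : Definable fun x e => e i ∈ guards x := by
  have h : Definable fun x (e : Fin d → ℕ) => e i < varCount x :=
    ((firstOcc 0).lt_count i).congr fun _ _ _ => Iff.rfl
  refine ((lt_length i).and ((eq_zero i).or ((two_pow i).and h))).congr fun x e he => ?_
  simp only [guards, Finset.mem_filter, Finset.mem_range]
  tauto

end PointerProg.Definable

/-! ### Definability of the adjacency relation. -/

namespace PointerProg.Definable

open CNFWord Classical

variable {d : ℕ}

theorem length_pos : Definable fun x (_ : Fin d → ℕ) => 0 < x.length :=
  (const True).ex.congr fun x _ _ => by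
    simpa using ⟨fun ⟨a, ha⟩ => by omega, fun h => ⟨0, h⟩⟩

theorem digit_eq (β : Bool) (i j : Fin d) :
    Definable fun x e => CNFWord.digit x (e i) (litName x (e j)) = β := by
  cases β
  · exact (digit i j).not.congr fun _ _ _ => by simp
  · exact digit i j

theorem slot_eq_none (r : ℕ) (i : Fin d) : Definable fun x e => slot x (e i) r = none :=
  (litAt r i.succ 0).ex.not.congr fun _ _ _ => slot_eq_none_iff.symm

theorem slot_eq_some (r : ℕ) (b : Bool) (i j : Fin d) :
    Definable fun x e => slot x (e i) r = some (litName x (e j), b) :=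
  ((litAt r i.succ 0).and ((litName_eq 0 j.succ).and (sym 0 (.lit b)))).ex.congr
    fun x e _ => by rw [slot_eq_some_iff]; exact Iff.rfl

theorem exists_slot_eq (r : ℕ) (b : Bool) (i : Fin d) :
    Definable fun x e => ∃ a, slot x (e i) r = some (a, b) := by
  have h : Definable fun x (e : Fin (d + 1) → ℕ) =>
      LitAt x (e i.succ) r (e 0) ∧ x[e 0]? = some (.lit b) := (litAt _ _ _).and (sym _ _)
  refine h.ex.congr fun x e _ => ?_
  simp only [slot_eq_some_iff]
  exact ⟨fun ⟨l, hl, h, h'⟩ => ⟨_, l, hl, h, rfl, h'⟩, fun ⟨_, l, hl, h, _, h'⟩ => ⟨l, hl, h, h'⟩⟩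

theorem exists_slot_digit (r : ℕ) (β : Bool) (i q : Fin d) :
    Definable fun x e => ∃ a b, slot x (e i) r = some (a, b) ∧ CNFWord.digit x (e q) a = β := by
  have h : Definable fun x (e : Fin (d + 1) → ℕ) =>
      LitAt x (e i.succ) r (e 0) ∧ CNFWord.digit x (e q.succ) (litName x (e 0)) = β :=
    (litAt _ _ _).and (digit_eq _ _ _)
  refine h.ex.congr fun x e _ => ?_
  simp only [slot_eq_some_iff]
  constructor
  · rintro ⟨l, hl, h, h'⟩
    obtain ⟨b, hb⟩ := h.2.1
    exact ⟨_, b, ⟨l, hl, h, rfl, hb⟩, h'⟩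
  · rintro ⟨_, b, ⟨l, hl, h, rfl, hb⟩, h'⟩
    exact ⟨l, hl, h, h'⟩

/-- Names are words, over which no quantifier is available; a common name is instead represented by
a position at which it occurs. -/
theorem slot_eq_slot (r : ℕ) (i j : Fin d) :
    Definable fun x e => slot x (e i) r = slot x (e j) r := by
  have h : ∀ b, Definable fun x (e : Fin (d + 1) → ℕ) => slot x (e i.succ) r =
      some (litName x (e 0), b) ∧ slot x (e j.succ) r = some (litName x (e 0), b) :=
    fun b => (slot_eq_some _ _ _ _).and (slot_eq_some _ _ _ _)
  refine (((slot_eq_none r i).and (slot_eq_none r j)).or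
    ((h true).ex.or (h false).ex)).congr fun x e _ => ?_
  change ((slot x (e i) r = none ∧ slot x (e j) r = none) ∨
    (∃ l < x.length, slot x (e i) r = some (litName x l, true) ∧
      slot x (e j) r = some (litName x l, true)) ∨
    ∃ l < x.length, slot x (e i) r = some (litName x l, false) ∧
      slot x (e j) r = some (litName x l, false)) ↔ _
  constructor
  · rintro (⟨h, h'⟩ | ⟨l, -, h, h'⟩ | ⟨l, -, h, h'⟩) <;> rw [h, h']
  · intro h
    rcases hs : slot x (e i) r with _ | ⟨a, b⟩
    · exact Or.inl ⟨rfl, by rw [← h, hs]⟩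
    · obtain ⟨l, hl, -, rfl, -⟩ := slot_eq_some_iff.1 hs
      rw [← h, hs]
      cases b
      · exact Or.inr (Or.inr ⟨l, hl, rfl, rfl⟩)
      · exact Or.inr (Or.inl ⟨l, hl, rfl, rfl⟩)

theorem isW (τ : WKind) (i : Fin d) : Definable fun x e => (system x).IsW τ (e i) := by
  cases τ with
  | fls | tru | extra => exact (eq_zero i).and length_pos
  | var => exact firstOcc i
  | cl => exact sym i .clause

theorem clash (τ τ' : WKind) (i j : Fin d) :
    Definable fun x e => (system x).Clash τ (e i) τ' (e j) := by
  cases τ <;> cases τ' <;> first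
    | exact (const True).congr fun _ _ _ => Iff.rfl
    | exact (const False).congr fun _ _ _ => Iff.rfl
    | exact (eq i j).congr fun _ _ _ => Iff.rfl
    | exact (slot_eq_none _ i).congr fun _ _ _ => Iff.rfl
    | exact (slot_eq_some _ _ i j).congr fun _ _ _ => Iff.rfl
    | skip
  rename_i r r'
  exact ((const (r ≠ r')).and
    (forall_fintype fun r'' : Fin 3 => slot_eq_slot r'' i j)).congr fun _ _ _ => Iff.rfl

theorem hasFeat (F : Feat) (τ : WKind) (q i : Fin d) :
    Definable fun x e => (system x).HasFeat (e q) F τ (e i) := by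
  cases F with
  | all τ' => exact const _
  | varBit b β => exact (const _).and (digit_eq β q i)
  | missing r r' => exact (const _).and (slot_eq_none r' i)
  | sign r r' b => exact (const _).and (exists_slot_eq r' b i)
  | clBit r r' β => exact (const _).and (exists_slot_digit r' β i q)

theorem inPair (F : Feat × Feat) (τ : WKind) (q i : Fin d) :
    Definable fun x e => (system x).InPair F (e q) τ (e i) :=
  (hasFeat _ _ _ _).or (hasFeat _ _ _ _)

theorem isVert (τ : VKind) (i : Fin d) : Definable fun x e => (system x).IsVert τ (e i) := by
  cases τ with
  | hub => exact (eq_zero i).and length_pos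
  | w τ => exact isW τ i
  | guard => exact mem_guards i

theorem _root_.CNFWord.lt_length_of_isVert {x : List CNFSymbol} {τ : VKind} {p : ℕ}
    (h : (system x).IsVert τ p) : p < x.length := by
  cases τ with
  | hub => exact h.1.trans_lt h.2
  | w τ =>
    cases τ with
    | fls | tru | extra => exact h.1.trans_lt h.2
    | var => exact h.1.lt_length
    | cl => exact (List.getElem?_eq_some_iff.1 h).1
  | guard => exact Finset.mem_range.1 (Finset.mem_filter.1 h).1

theorem good (F : Feat × Feat) (q : Fin d) : Definable fun x e => (system x).Good F (e q) := by
  have h : ∀ τ τ', Definable fun x (e : Fin (d + 2) → ℕ) =>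
      (system x).IsW τ (e 1) → (system x).IsW τ' (e 0) →
      (system x).InPair F (e q.succ.succ) τ (e 1) →
      (system x).InPair F (e q.succ.succ) τ' (e 0) →
      ¬ (τ = τ' ∧ e 1 = e 0) → ¬ (system x).Clash τ (e 1) τ' (e 0) := fun τ τ' =>
    (isW _ _).imp ((isW _ _).imp ((inPair _ _ _ _).imp ((inPair _ _ _ _).imp
      (((const _).and (eq _ _)).not.imp (clash _ _ _ _).not))))
  refine (forall_fintype fun τ => forall_fintype fun τ' => (h τ τ').all.all).congr
    fun x e _ => ?_
  constructor
  · intro h τ τ' p p' hp hp' hi hi' hne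
    exact h τ τ' p (lt_length_of_isVert (τ := .w τ) hp) p' (lt_length_of_isVert (τ := .w τ') hp')
      hp hp' hi hi' fun hc => hne (Prod.ext hc.1 hc.2)
  · intro h τ τ' p _ p' _ hp hp' hi hi' hne
    exact h τ τ' p p' hp hp' hi hi' fun hc => hne ⟨congrArg Prod.fst hc, congrArg Prod.snd hc⟩

theorem joined (τ τ' : VKind) (i j : Fin d) :
    Definable fun x e => (system x).Joined τ (e i) τ' (e j) := by
  cases τ <;> cases τ' <;> try exact (const False).congr fun _ _ _ => Iff.rfl
  · exact (eq_zero i).and (isW _ j)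
  · exact (isW _ i).and ((isW _ j).and ((clash _ _ i j).not.and (clash _ _ j i).not))
  · exact (mem_guards i).and ((isW _ j).and ((inPair _ _ i j).and (good _ i)))
  · exact (mem_guards i).and ((const _).and (eq i j))

theorem adj (τ τ' : VKind) (i j : Fin d) :
    Definable fun x e => (system x).graph.Adj (τ, e i) (τ', e j) := by
  refine (((const (τ = τ')).and (eq i j)).not.and
    ((joined τ τ' i j).or (joined τ' τ j i))).congr fun x e _ => ?_
  simp [ClauseSystem.graph, SimpleGraph.fromRel_adj]

end PointerProg.Definable

/-! ### The instance of Edge Clique Cover -/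

namespace CNFWord

open Classical

/-- All kinds of vertices. -/
@[irreducible] noncomputable def kinds : List VKind :=
  (Set.finite_univ (α := VKind)).toFinset.toList

theorem mem_kinds (τ : VKind) : τ ∈ kinds := by
  unfold kinds
  exact Finset.mem_toList.2 ((Set.Finite.mem_toFinset _).2 (Set.mem_univ τ))

theorem nodup_kinds : kinds.Nodup := by
  unfold kinds
  exact Finset.nodup_toList _

/-- The vertices of the graph of a formula. -/
noncomputable def vertices (x : List CNFSymbol) : List (VKind × ℕ) :=
  kinds.flatMap fun τ => (List.range x.length).flatMap fun p =>
    if (system x).IsVert τ p then [(τ, p)] else []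

variable {x : List CNFSymbol}

theorem mem_vertices {v : VKind × ℕ} : v ∈ vertices x ↔ (system x).IsVert v.1 v.2 := by
  simp only [vertices, List.mem_flatMap, List.mem_range]
  constructor
  · rintro ⟨τ, -, p, -, h⟩
    split_ifs at h with hp
    · obtain rfl := List.mem_singleton.1 h
      exact hp
    · simp at h
  · exact fun h => ⟨v.1, mem_kinds _, v.2, lt_length_of_isVert h, by simp [h]⟩

theorem nodup_vertices : (vertices x).Nodup := by
  unfold vertices
  rw [List.nodup_flatMap]
  constructor
  · intro τ _
    rw [List.nodup_flatMap]
    constructor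
    · intro p _
      split_ifs <;> simp
    · refine List.Pairwise.imp ?_ List.nodup_range
      intro p q hpq
      simp only [Function.onFun]
      split_ifs <;> simp [hpq.symm]
  · refine List.Pairwise.imp ?_ nodup_kinds
    intro τ τ' h u hu hu'
    simp only [List.mem_flatMap] at hu hu'
    obtain ⟨p, -, hp⟩ := hu
    obtain ⟨p', -, hp'⟩ := hu'
    split_ifs at hp hp' <;> simp at hp hp'
    rw [hp] at hp'
    exact h (congrArg Prod.fst hp')

/-- The instance of Edge Clique Cover for a formula. -/
noncomputable def eccInstance (x : List CNFSymbol) : ECCInstance where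
  numVerts := (vertices x).length
  graph := (system x).graph.comap (vertices x).get
  k := (system x).budget

theorem isYes_eccInstance : (eccInstance x).IsYes ↔ (system x).Sat := by
  rw [← ClauseSystem.hasEdgeCliqueCover_iff]
  refine hasEdgeCliqueCover_comap_iff _ _ (List.nodup_iff_injective_get.1 nodup_vertices) ?_ _
  intro u v h
  exact List.mem_iff_get.1 (mem_vertices.2 (ClauseSystem.isVert_of_adj h).1)

/-- The encoding is rewritten as nested loops over kinds and positions, the form in which it can be
emitted. The unary budget is printed by a loop over feature pairs and guards. -/
theorem encodeECC_eccInstance : encodeECC (eccInstance x) =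
    ((vertices x).flatMap fun u => .row :: (vertices x).flatMap fun v =>
      [.entry (decide ((system x).graph.Adj u v))]) ++
    (List.replicate 4 .budget ++ featPairs.toList.flatMap fun _ =>
      (List.range x.length).flatMap fun q => if q ∈ guards x then [.budget] else []) := by
  unfold encodeECC
  congr 1
  · have key : ∀ (l : List (VKind × ℕ)) (g : VKind × ℕ → List ECCSymbol),
        (List.finRange l.length).flatMap (fun i => g (l.get i)) = l.flatMap g := by
      intro l g
      conv_rhs => rw [← List.map_get_finRange l]
      rw [List.flatMap_map]
    rw [← key]
    refine List.flatMap_congr fun u _ => ?_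
    rw [← key, encodeRow, List.map_eq_flatMap]
    rfl
  · change List.replicate (4 + featPairs.card * (guards x).card) ECCSymbol.budget = _
    rw [List.replicate_add]
    congr 1
    symm
    rw [List.eq_replicate_iff]
    constructor
    · have h : ((List.range x.length).flatMap fun q =>
          if q ∈ guards x then [ECCSymbol.budget] else []).length = (guards x).card := by
        rw [List.length_flatMap]
        have : (fun q => (if q ∈ guards x then [ECCSymbol.budget] else []).length) =
            fun q => if q ∈ guards x then 1 else 0 := by
          funext q
          split_ifs <;> rfl
        rw [this, ← List.sum_toFinset _ List.nodup_range, List.toFinset_range, Finset.sum_boole,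
          Finset.filter_mem_eq_inter, Finset.inter_eq_right.2
            (show guards x ⊆ Finset.range x.length from Finset.filter_subset _ _)]
        rfl
      rw [List.length_flatMap, List.map_const', List.sum_replicate, h, Finset.length_toList]
      rfl
    · intro b hb
      simp only [List.mem_flatMap] at hb
      obtain ⟨-, -, q, -, hb⟩ := hb
      split_ifs at hb <;> simp at hb
      exact hb

end CNFWord

/-! ### Printing the instance. -/

namespace PointerProg

open CNFWord Classical

variable {d : ℕ}

theorem Emittable.vertices_flatMap
    {g : VKind → List CNFSymbol → (Fin (d + 1) → ℕ) → List ECCSymbol}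
    (hg : ∀ τ, Emittable (g τ)) :
    Emittable fun x e => (vertices x).flatMap fun v => g v.1 x (Fin.cons v.2 e) := by
  refine (Emittable.flatMap kinds fun τ _ =>
    (Emittable.ite (Definable.isVert τ 0) (hg τ) .nil).range_flatMap).congr fun x e _ => ?_
  unfold vertices
  rw [List.flatMap_assoc]
  refine List.flatMap_congr fun τ _ => ?_
  rw [List.flatMap_assoc]
  refine List.flatMap_congr fun p _ => ?_
  simp only [Fin.cons_zero]
  split_ifs <;> simp

theorem emittable_entry (τ τ' : VKind) (i j : Fin d) : Emittable fun x e =>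
    [ECCSymbol.entry (decide ((system x).graph.Adj (τ, e i) (τ', e j)))] := by
  refine (Emittable.ite (Definable.adj τ τ' i j) (.singleton (.entry true))
    (.singleton (.entry false))).congr fun x e _ => ?_
  split_ifs with h
  · rw [decide_eq_true h]
  · rw [decide_eq_false h]

theorem emittable_row (τ : VKind) (i : Fin d) : Emittable fun x e => ECCSymbol.row ::
    (vertices x).flatMap fun v => [ECCSymbol.entry (decide ((system x).graph.Adj (τ, e i) v))] :=
  ((Emittable.singleton .row).append
    (Emittable.vertices_flatMap fun τ' => emittable_entry τ τ' i.succ 0)).congr fun _ _ _ => rfl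

theorem emittable_budget : Emittable fun x (_ : Fin d → ℕ) =>
    List.replicate 4 ECCSymbol.budget ++ featPairs.toList.flatMap fun _ =>
      (List.range x.length).flatMap fun q =>
        if q ∈ guards x then [ECCSymbol.budget] else [] := by
  have h : Emittable fun x (e : Fin (d + 1) → ℕ) =>
      if e 0 ∈ guards x then [ECCSymbol.budget] else [] :=
    (Emittable.ite (Definable.mem_guards 0) (.singleton .budget) .nil).congr
      fun _ _ _ => by congr
  refine Emittable.append ?_ (.flatMap _ fun _ _ => h.range_flatMap)
  exact ((Emittable.singleton .budget).append ((Emittable.singleton .budget).append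
    ((Emittable.singleton .budget).append (.singleton .budget)))).congr fun _ _ _ => rfl

theorem emittable_encodeECC : Emittable fun x (_ : Fin 0 → ℕ) => encodeECC (eccInstance x) := by
  refine ((Emittable.vertices_flatMap fun τ => emittable_row τ 0).append
    emittable_budget).congr fun x e _ => ?_
  rw [encodeECC_eccInstance]
  simp only [Fin.cons_zero]

end PointerProg

/-! ### Words of formulas -/

theorem List.exists_of_getElem?_flatMap {α β : Type*} (f : α → List β) {L : List α} {t : ℕ} {s : β}
    (h : (L.flatMap f)[t]? = some s) : ∃ L₁ b L₂ u, L = L₁ ++ b :: L₂ ∧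
      t = (L₁.flatMap f).length + u ∧ (f b)[u]? = some s := by
  induction L generalizing t with
  | nil => simp at h
  | cons b L ih =>
    rw [List.flatMap_cons] at h
    by_cases ht : t < (f b).length
    · rw [List.getElem?_append_left ht] at h
      exact ⟨[], b, L, t, rfl, by simp, h⟩
    · rw [List.getElem?_append_right (not_lt.1 ht)] at h
      obtain ⟨L₁, b', L₂, u, rfl, hu, h⟩ := ih h
      exact ⟨b :: L₁, b', L₂, u, rfl, by rw [List.flatMap_cons, List.length_append]; omega, h⟩

theorem countBelow_le_countP {α : Type*} (Q : α → Bool) (l : List α) :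
    countBelow l.length (fun t => ∃ s, l[t]? = some s ∧ Q s) ≤ l.countP Q := by
  classical
  unfold countBelow
  induction l with
  | nil => simp
  | cons a l ih =>
    rw [List.countP_cons, List.length_cons]
    have h : (Finset.range (l.length + 1)).filter (fun t => ∃ s, (a :: l)[t]? = some s ∧ Q s) ⊆
        ((Finset.range l.length).filter fun t => ∃ s, l[t]? = some s ∧ Q s).image (· + 1) ∪
          (if Q a then {0} else ∅) := by
      intro t
      simp only [Finset.mem_filter, Finset.mem_range, Finset.mem_union, Finset.mem_image]
      rcases t with _ | t
      · rintro ⟨-, s, hs, hQ⟩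
        obtain rfl : a = s := by simpa using hs
        exact Or.inr (by simp [hQ])
      · rintro ⟨ht, s, hs, hQ⟩
        exact Or.inl ⟨t, ⟨by omega, s, by simpa using hs, hQ⟩, rfl⟩
    refine (Finset.card_le_card h).trans ((Finset.card_union_le _ _).trans
      (add_le_add (Finset.card_image_le.trans ?_) ?_))
    · convert ih
    · split_ifs <;> simp

theorem countBelow_le_of_injOn {n n' : ℕ} {P Q : ℕ → Prop} (g : ℕ → ℕ)
    (h : ∀ a < n, P a → g a < n' ∧ Q (g a)) (hg : ∀ a b, P a → P b → g a = g b → a = b) :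
    countBelow n P ≤ countBelow n' Q := by
  classical
  unfold countBelow
  refine Finset.card_le_card_of_injOn g ?_ ?_
  · intro a ha
    simp only [Finset.coe_filter, Finset.mem_range, Set.mem_ofPred_eq] at ha ⊢
    exact h a ha.1 ha.2
  · intro a ha b hb hab
    simp only [Finset.coe_filter, Finset.mem_range, Set.mem_ofPred_eq] at ha hb
    exact hg a b ha.2 hb.2 hab

theorem countBelow_mono {n : ℕ} {P Q : ℕ → Prop} (h : ∀ a < n, P a → Q a) :
    countBelow n P ≤ countBelow n Q :=
  countBelow_le_of_injOn id (fun a ha hP => ⟨ha, h a ha hP⟩) fun _ _ _ _ => id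

/-! ### Parsing the word of a formula. -/

namespace CNFWord

/-- The digits of a variable. -/
def varName (v : ℕ) : List CNFSymbol := (Computability.encodeNat v).map .bit

theorem varName_injective : Function.Injective varName := by
  intro v w h
  have h' := List.map_injective_iff.2 (fun a b h => CNFSymbol.bit.inj h) h
  rw [← Computability.decode_encodeNat v, h', Computability.decode_encodeNat]

/-- The word of a formula. -/
def word (φ : CNFFormula) : List CNFSymbol := φ.flatMap encodeClause

variable {φ φ₁ φ₂ : CNFFormula} {c c₁ c₂ : Clause} {v l p : ℕ} {b : Bool}

theorem mem_encodeLits {s : CNFSymbol} (h : s ∈ c.flatMap encodeLit) : s ≠ .clause := by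
  rintro rfl
  simp [encodeLit] at h

theorem getElem?_varName_ne {u : ℕ} : (varName v)[u]? ≠ some (.lit b) := by
  intro h
  have := List.mem_of_getElem? h
  simp [varName] at this

theorem word_eq (hφ : φ = φ₁ ++ c :: φ₂) (hc : c = c₁ ++ (v, b) :: c₂) :
    word φ = (word φ₁ ++ .clause :: c₁.flatMap encodeLit) ++
      .lit b :: (varName v ++ (c₂.flatMap encodeLit ++ word φ₂)) := by
  subst hφ hc
  simp [word, encodeClause, encodeLit, varName]

theorem exists_of_getElem?_eq_clause (h : (word φ)[p]? = some .clause) :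
    ∃ φ₁ c φ₂, φ = φ₁ ++ c :: φ₂ ∧ p = (word φ₁).length := by
  obtain ⟨φ₁, c, φ₂, u, hφ, rfl, hu⟩ := List.exists_of_getElem?_flatMap _ h
  rcases u with _ | u
  · exact ⟨φ₁, c, φ₂, hφ, rfl⟩
  · exact absurd rfl (mem_encodeLits (c := c) (List.mem_of_getElem? hu))

theorem exists_of_getElem?_eq_lit (h : (word φ)[l]? = some (.lit b)) :
    ∃ φ₁ c φ₂ c₁ v c₂, φ = φ₁ ++ c :: φ₂ ∧ c = c₁ ++ (v, b) :: c₂ ∧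
      l = (word φ₁).length + 1 + (c₁.flatMap encodeLit).length := by
  obtain ⟨φ₁, c, φ₂, u, hφ, rfl, hu⟩ := List.exists_of_getElem?_flatMap _ h
  rcases u with _ | u
  · simp [encodeClause] at hu
  rw [encodeClause, List.getElem?_cons_succ] at hu
  obtain ⟨c₁, ⟨v, b'⟩, c₂, u, hc, rfl, hv⟩ := List.exists_of_getElem?_flatMap _ hu
  rcases u with _ | u
  · obtain rfl : b' = b := by simpa [encodeLit] using hv
    exact ⟨φ₁, c, φ₂, c₁, v, c₂, hφ, hc, by rw [word]; omega⟩
  · exact absurd hv getElem?_varName_ne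

theorem length_prefix : (word φ₁ ++ .clause :: c₁.flatMap encodeLit).length =
    (word φ₁).length + 1 + (c₁.flatMap encodeLit).length := by
  rw [List.length_append, List.length_cons]
  omega

theorem getElem?_word_clause (hφ : φ = φ₁ ++ c :: φ₂) :
    (word φ)[(word φ₁).length]? = some .clause := by
  subst hφ
  simp [word, encodeClause, -List.length_flatMap]

theorem getElem?_word_lit (hφ : φ = φ₁ ++ c :: φ₂) (hc : c = c₁ ++ (v, b) :: c₂) :
    (word φ)[(word φ₁).length + 1 + (c₁.flatMap encodeLit).length]? = some (.lit b) := by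
  rw [word_eq hφ hc, ← length_prefix, List.getElem?_append_right le_rfl, Nat.sub_self]
  rfl

theorem getElem?_word_lits (hφ : φ = φ₁ ++ c :: φ₂) (hc : c = c₁ ++ (v, b) :: c₂) {u : ℕ}
    (h : (word φ₁).length < u) (h' : u < (word φ₁).length + 1 + (c₁.flatMap encodeLit).length) :
    (word φ)[u]? = (c₁.flatMap encodeLit)[u - (word φ₁).length - 1]? := by
  rw [word_eq hφ hc, List.getElem?_append_left (by rwa [length_prefix]),
    List.getElem?_append_right h.le]
  obtain ⟨t, rfl⟩ : ∃ t, u = (word φ₁).length + t + 1 := ⟨u - (word φ₁).length - 1, by omega⟩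
  rw [show (word φ₁).length + t + 1 - (word φ₁).length = t + 1 by omega]
  rfl

theorem litName_word (hφ : φ = φ₁ ++ c :: φ₂) (hc : c = c₁ ++ (v, b) :: c₂) :
    litName (word φ) ((word φ₁).length + 1 + (c₁.flatMap encodeLit).length) = varName v := by
  have h : (c₂.flatMap encodeLit ++ word φ₂).takeWhile isBit = [] := by
    rcases c₂ with _ | ⟨l, c₂⟩
    · rcases φ₂ with _ | ⟨c', φ₂⟩ <;> rfl
    · rfl
  rw [litName, word_eq hφ hc, ← length_prefix, List.drop_length_add_append]
  change (varName v ++ _).takeWhile isBit = _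
  rw [List.takeWhile_append_of_pos, h, List.append_nil]
  intro s hs
  obtain ⟨b, -, rfl⟩ := List.mem_map.1 hs
  rfl

/-- The number of the literal is the count of signs before it in its clause. An upper bound for this
count suffices, since any number below 3 will do. -/
theorem litAt_word (hφ : φ = φ₁ ++ c :: φ₂) (hc : c = c₁ ++ (v, b) :: c₂) (h3 : c.length ≤ 3) :
    ∃ r : Fin 3, LitAt (word φ) (word φ₁).length r
      ((word φ₁).length + 1 + (c₁.flatMap encodeLit).length) := by
  let isSign : CNFSymbol → Bool := fun s => decide (∃ b, s = .lit b)
  have hcount : (c₁.flatMap encodeLit).countP isSign = c₁.length := by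
    clear hφ hc h3
    induction c₁ with
    | nil => rfl
    | cons l c₁ ih =>
      have : ((Computability.encodeNat l.1).map CNFSymbol.bit).countP isSign = 0 := by
        rw [List.countP_eq_zero]
        intro s hs
        obtain ⟨b, -, rfl⟩ := List.mem_map.1 hs
        simp [isSign]
      rw [List.flatMap_cons, List.countP_append, ih, encodeLit, List.countP_cons, this]
      simp [isSign]
      omega
  have hle : countBelow (word φ).length (fun u => (word φ₁).length < u ∧
      u < (word φ₁).length + 1 + (c₁.flatMap encodeLit).length ∧ IsLit (word φ) u) ≤
      c₁.length := by
    refine le_trans ?_ ((countBelow_le_countP isSign (c₁.flatMap encodeLit)).trans hcount.le)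
    refine countBelow_le_of_injOn (fun u => u - (word φ₁).length - 1) ?_ ?_
    · rintro u _ ⟨h₁, h₂, b, h₃⟩
      rw [getElem?_word_lits hφ hc h₁ h₂] at h₃
      exact ⟨(List.getElem?_eq_some_iff.1 h₃).1, _, h₃, by simp [isSign]⟩
    · rintro u u' ⟨h₁, -⟩ ⟨h₂, -⟩ h
      omega
  have hlt : c₁.length < 3 := by
    rw [hc] at h3
    simp at h3
    omega
  refine ⟨⟨_, hle.trans_lt hlt⟩, by omega, ⟨b, getElem?_word_lit hφ hc⟩, fun u _ h₁ h₂ h => ?_, rfl⟩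
  rw [getElem?_word_lits hφ hc h₁ h₂] at h
  exact mem_encodeLits (List.mem_of_getElem? h) rfl

/-- Every clause contributes at least its marker, so prefixes of a formula are determined by the
lengths of their words. -/
theorem eq_of_length_eq {ψ₁ ψ₂ : CNFFormula} {c' : Clause} (h : φ₁ ++ c :: φ₂ = ψ₁ ++ c' :: ψ₂)
    (hl : (word φ₁).length = (word ψ₁).length) : c = c' := by
  have key : ∀ as : CNFFormula, (word as).length = 0 → as = [] := by
    rintro (_ | ⟨a, as⟩) h
    · rfl
    · simp [word, encodeClause] at h
  rcases List.append_eq_append_iff.1 h with ⟨as, rfl, h⟩ | ⟨as, rfl, h⟩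
  all_goals
    obtain rfl := key as (by simp [word] at hl ⊢; omega)
    simp at h
    exact h.1

theorem exists_of_litAt {r : ℕ} (hφ : φ = φ₁ ++ c :: φ₂) (h : LitAt (word φ) (word φ₁).length r l) :
    ∃ c₁ v b c₂, c = c₁ ++ (v, b) :: c₂ ∧
      l = (word φ₁).length + 1 + (c₁.flatMap encodeLit).length := by
  obtain ⟨hpl, ⟨b, hb⟩, hno, -⟩ := h
  obtain ⟨ψ₁, c', ψ₂, c₁, v, c₂, hψ, hc, hl⟩ := exists_of_getElem?_eq_lit hb
  have hlen : (word φ₁).length = (word ψ₁).length := by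
    -- If the literal belonged to a later clause, the marker of that clause would lie between; if to
    -- an earlier one, the marker at `(word φ₁).length` would lie among its literals.
    rcases lt_trichotomy (word φ₁).length (word ψ₁).length with h | h | h
    · have := getElem?_word_clause hψ
      exact absurd this (hno _ (List.getElem?_eq_some_iff.1 this).1 h (by omega))
    · exact h
    · have h₁ := getElem?_word_clause hφ
      rw [getElem?_word_lits hψ hc h (by omega)] at h₁
      exact absurd rfl (mem_encodeLits (List.mem_of_getElem? h₁))
  obtain rfl := eq_of_length_eq (hφ.symm.trans hψ) hlen
  exact ⟨c₁, v, b, c₂, hc, hlen ▸ hl⟩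

theorem sat_system_iff (h3 : ∀ c ∈ φ, c.length ≤ 3) : (system (word φ)).Sat ↔ φ.Satisfiable := by
  classical
  constructor
  · rintro ⟨f, hf⟩
    refine ⟨fun v => f (varName v), fun c hc => ?_⟩
    obtain ⟨φ₁, φ₂, hφ⟩ := List.append_of_mem hc
    obtain ⟨r, a, b, hs, hb⟩ := hf _ (getElem?_word_clause hφ)
    obtain ⟨l, -, hl, rfl, hlb⟩ := slot_eq_some_iff.1 hs
    obtain ⟨c₁, v, b', c₂, hc, rfl⟩ := exists_of_litAt hφ hl
    rw [getElem?_word_lit hφ hc] at hlb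
    rw [litName_word hφ hc] at hb
    refine ⟨(v, b'), by simp [hc], hb.trans ?_⟩
    simpa using hlb.symm
  · rintro ⟨a, ha⟩
    refine ⟨fun s => decide (∃ v, s = varName v ∧ a v = true), fun p hp => ?_⟩
    obtain ⟨φ₁, c, φ₂, hφ, rfl⟩ := exists_of_getElem?_eq_clause hp
    have hmem : c ∈ φ := by simp [hφ]
    obtain ⟨⟨v, b⟩, hv, hb⟩ := ha c hmem
    obtain ⟨c₁, c₂, hc⟩ := List.append_of_mem hv
    obtain ⟨r, hr⟩ := litAt_word hφ hc (h3 c hmem)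
    refine ⟨r, varName v, b, slot_eq_some_iff.2 ⟨_, hr.2.1.lt_length, hr, litName_word hφ hc,
      getElem?_word_lit hφ hc⟩, ?_⟩
    have : (∃ w, varName v = varName w ∧ a w = true) ↔ a v = true :=
      ⟨fun ⟨w, h, hw⟩ => varName_injective h ▸ hw, fun h => ⟨v, rfl, h⟩⟩
    change a v = b at hb
    rw [← hb, Bool.eq_iff_iff, decide_eq_true_eq]
    exact this

/-- First occurrences of literals are mapped injectively to the names of the variables. -/
theorem varCount_word_le : varCount (word φ) ≤ φ.numVars := by
  classical
  unfold varCount countBelow CNFFormula.numVars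
  rw [← Finset.card_image_of_injective φ.vars varName_injective]
  refine Finset.card_le_card_of_injOn (litName (word φ)) ?_ ?_
  · intro l hl
    obtain ⟨b, hb⟩ := (Finset.mem_filter.1 hl).2.1
    obtain ⟨φ₁, c, φ₂, c₁, v, c₂, hφ, hc, rfl⟩ := exists_of_getElem?_eq_lit hb
    rw [litName_word hφ hc]
    refine Finset.mem_coe.2 (Finset.mem_image_of_mem _ ?_)
    simp only [CNFFormula.vars, List.mem_toFinset, List.mem_map, List.mem_flatten]
    exact ⟨(v, b), ⟨c, by simp [hφ], by simp [hc]⟩, rfl⟩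
  · intro l hl l' hl' h
    exact (Finset.mem_filter.1 hl).2.eq (Finset.mem_filter.1 hl').2 h

theorem countBelow_clause_le :
    countBelow (word φ).length (fun p => (word φ)[p]? = some .clause) ≤ φ.numClauses := by
  refine (countBelow_mono (Q := fun t => ∃ s, (word φ)[t]? = some s ∧ decide (s = .clause) = true)
    (fun p _ h => ⟨_, h, by simp⟩)).trans ((countBelow_le_countP _ _).trans ?_)
  unfold CNFFormula.numClauses word
  induction φ with
  | nil => simp
  | cons c φ ih =>
    have : (c.flatMap encodeLit).countP (fun s => decide (s = .clause)) = 0 := by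
      rw [List.countP_eq_zero]
      exact fun s hs => by simpa using mem_encodeLits hs
    rw [List.flatMap_cons, List.countP_append, encodeClause, List.countP_cons, this]
    simp
    omega

end CNFWord

/-! ### Size of the instance -/

theorem countBelow_le_card {n : ℕ} {P : ℕ → Prop} (s : Finset ℕ) (h : ∀ a, P a → a ∈ s) :
    countBelow n P ≤ s.card := by
  classical
  exact Finset.card_le_card fun a ha => h a (Finset.mem_filter.1 ha).2

namespace CNFWord

variable {φ : CNFFormula}

theorem card_guards_le (x : List CNFSymbol) : (guards x).card ≤ Nat.log 2 (varCount x) + 2 := by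
  classical
  have h : guards x ⊆ insert 0 ((Finset.range (Nat.log 2 (varCount x) + 1)).image (2 ^ ·)) := by
    intro q hq
    obtain ⟨-, rfl | ⟨⟨k, rfl⟩, hk⟩⟩ := Finset.mem_filter.1 hq
    · simp
    · refine Finset.mem_insert_of_mem (Finset.mem_image_of_mem _ ?_)
      exact Finset.mem_range.2 (Nat.lt_succ_of_le (Nat.le_log_of_pow_le (by norm_num) hk.le))
  refine (Finset.card_le_card h).trans ((Finset.card_insert_le _ _).trans ?_)
  exact Nat.succ_le_succ (Finset.card_image_le.trans (by simp))

theorem numVerts_eccInstance_le {x : List CNFSymbol} {B : ℕ}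
    (h : ∀ τ, countBelow x.length ((system x).IsVert τ) ≤ B) :
    (eccInstance x).numVerts ≤ kinds.length * B := by
  classical
  change (vertices x).length ≤ _
  unfold vertices
  rw [List.length_flatMap, ← List.length_map (as := kinds) (f := fun τ =>
    ((List.range x.length).flatMap fun p => if (system x).IsVert τ p then [(τ, p)] else []).length)]
  refine List.sum_le_card_nsmul _ B fun n hn => ?_
  obtain ⟨τ, -, rfl⟩ := List.mem_map.1 hn
  refine le_trans (le_of_eq ?_) (h τ)
  rw [List.length_flatMap, ← List.sum_toFinset _ List.nodup_range, List.toFinset_range,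
    countBelow, Finset.card_filter]
  exact Finset.sum_congr rfl fun p _ => by split_ifs <;> rfl

/-- A single vertex, present only for a nonempty formula, is paid for by a clause. Nonzero guards
are smaller than the number of variables, and the guard 0 is again paid for by a clause. -/
theorem countBelow_isVert_le (τ : VKind) :
    countBelow (word φ).length ((system (word φ)).IsVert τ) ≤ φ.numVars + φ.numClauses := by
  classical
  have hm : (system (word φ)).Nonempty → 1 ≤ φ.numClauses := by
    intro h
    rcases φ with _ | ⟨c, φ⟩
    · exact absurd h (lt_irrefl 0)
    · simp [CNFFormula.numClauses]
  have hzero : countBelow (word φ).length (fun p => p = 0 ∧ (system (word φ)).Nonempty) ≤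
      φ.numVars + φ.numClauses := by
    by_cases h : (system (word φ)).Nonempty
    · have h₁ : countBelow (word φ).length (fun p => p = 0 ∧ (system (word φ)).Nonempty) ≤
          ({0} : Finset ℕ).card := countBelow_le_card _ fun p hp => by simpa using hp.1
      have := hm h
      simp at h₁
      omega
    · simp [countBelow, h]
  have hvar : countBelow (word φ).length (FirstOcc (word φ)) ≤ φ.numVars := varCount_word_le
  have hcl := countBelow_clause_le (φ := φ)
  cases τ with
  | hub => exact hzero
  | w τ =>
    cases τ with
    | fls | tru | extra => exact hzero
    | var => exact hvar.trans (Nat.le_add_right _ _)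
    | cl => exact hcl.trans (Nat.le_add_left _ _)
  | guard =>
    have h₁ : countBelow (word φ).length (fun q => q ∈ guards (word φ)) ≤ (guards (word φ)).card :=
      countBelow_le_card _ fun _ => id
    by_cases h : (system (word φ)).Nonempty
    · have h₂ : guards (word φ) ⊆ insert 0 (Finset.Ioo 0 (varCount (word φ))) := by
        intro q hq
        rcases Nat.eq_zero_or_pos q with rfl | h
        · simp
        · obtain ⟨-, rfl | ⟨-, hq⟩⟩ := Finset.mem_filter.1 hq
          · simp
          · simp [h, hq]
      have h₃ := (Finset.card_le_card h₂).trans (Finset.card_insert_le _ _)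
      rw [Nat.card_Ioo] at h₃
      have := hm h
      have h₄ : varCount (word φ) ≤ φ.numVars := hvar
      change countBelow (word φ).length (fun q => q ∈ guards (word φ)) ≤ _
      omega
    · have h₂ : (word φ).length = 0 := by
        simpa [system] using h
      rw [h₂]
      simp [countBelow]

theorem log_le (n : ℕ) : (Nat.log 2 n : ℝ) ≤ 2 * Real.log n := by
  have h₁ := Real.natLog_le_logb n 2
  have h₂ : (1 / 2 : ℝ) ≤ Real.log 2 := by linarith [Real.log_two_gt_d9]
  have h₃ : 0 ≤ Real.log n := Real.log_natCast_nonneg n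
  refine h₁.trans ?_
  rw [Real.logb, Nat.cast_ofNat, div_le_iff₀ (by linarith)]
  nlinarith

theorem budget_le : ((eccInstance (word φ)).k : ℝ) ≤
    (4 + 2 * featPairs.card : ℝ) * (1 + Real.log φ.numVars) := by
  have h₁ : (guards (word φ)).card ≤ Nat.log 2 φ.numVars + 2 :=
    (card_guards_le _).trans (Nat.add_le_add_right (Nat.log_mono_right varCount_word_le) 2)
  have h₂ : ((guards (word φ)).card : ℝ) ≤ 2 * (1 + Real.log φ.numVars) := by
    have := log_le φ.numVars
    have h₁' : ((guards (word φ)).card : ℝ) ≤ Nat.log 2 φ.numVars + 2 := by exact_mod_cast h₁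
    linarith
  have h₃ : 0 ≤ Real.log φ.numVars := Real.log_natCast_nonneg _
  change ((4 + featPairs.card * (guards (word φ)).card : ℕ) : ℝ) ≤ _
  push_cast
  have := mul_le_mul_of_nonneg_left h₂ (Nat.cast_nonneg (α := ℝ) featPairs.card)
  linarith

end CNFWord

theorem theorem1 :
    ∃ (f : ThreeCNF → ECCInstance) (C : ℝ),
      Nonempty (Turing.TM2ComputableInPolyTime encodeThreeCNF encodeECC f) ∧
      ∀ φ : ThreeCNF,
        (CNFFormula.Satisfiable φ.1 ↔ (f φ).IsYes) ∧
        ((f φ).k : ℝ) ≤ C * (1 + Real.log (CNFFormula.numVars φ.1)) ∧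
        ((f φ).numVerts : ℝ) ≤
          C * ((CNFFormula.numVars φ.1 : ℝ) + (CNFFormula.numClauses φ.1 : ℝ)) := by
  refine ⟨fun φ => CNFWord.eccInstance (encodeThreeCNF φ),
    -- The first two summands bound the budget and the last one the number of vertices.
    4 + 2 * featPairs.card + CNFWord.kinds.length,
    PointerProg.tm2ComputableInPolyTime_of_emittable PointerProg.emittable_encodeECC
      fun _ => rfl, fun φ => ⟨?_, ?_, ?_⟩⟩
  · rw [CNFWord.isYes_eccInstance]
    exact (CNFWord.sat_system_iff φ.2).symm
  · refine CNFWord.budget_le.trans (mul_le_mul_of_nonneg_right ?_ ?_)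
    · simp
    · linarith [Real.log_natCast_nonneg (CNFFormula.numVars φ.1)]
  · have h := CNFWord.numVerts_eccInstance_le fun τ => CNFWord.countBelow_isVert_le (φ := φ.1) τ
    have h' : ((CNFWord.eccInstance (encodeThreeCNF φ)).numVerts : ℝ) ≤ CNFWord.kinds.length *
        ((CNFFormula.numVars φ.1 : ℝ) + (CNFFormula.numClauses φ.1 : ℝ)) := by exact_mod_cast h
    refine h'.trans (mul_le_mul_of_nonneg_right ?_ (by positivity))
    have : (0 : ℝ) ≤ 4 + 2 * featPairs.card := by positivity
    linarith
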